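/- Let $\mu>0$ and $\alpha,\beta\in\mathbb R$ with $1+\alpha\beta<0$ (Benjamin–Feir–Newell unstable regime; then $\alpha\ne\beta$), and consider the complex Ginzburg–Landau equation (CGLe) $$A_t=\mu A+(1+i\alpha)A_{xx}-(1+i\beta)|A|^2A .$$ For $\omega\in\mathbb R$ put $$a=\tfrac{(1+\alpha^2)^2}{4(\beta-\alpha)},\quad b=\tfrac{1+\alpha^2}{2}\Big(\tfrac{2(\alpha\omega+\mu)}{\beta-\alpha}-\tfrac{3(1+\alpha\beta)(\omega-\mu\alpha)}{(\beta-\alpha)^2}\Big),\quad c=-\tfrac{3(1+\alpha\beta)(1+\alpha^2)}{2(\beta-\alpha)^2},$$ $$d=\tfrac1{\beta-\alpha},\quad e=\tfrac{\omega-\mu\alpha}{\beta-\alpha}.$$ Let $\lambda$ be either root of $\lambda^2+c\lambda-2ad=0$, and put $\tilde e=\lambda b/a$, $k=\frac{\lambda}{a}(e-\tilde e)$, $\omega_1^2=\tilde e/\lambda$. Consider the 4-D system $$\dot{\tilde M}=\tilde NP,\quad \dot{\tilde N}=\tfrac{\lambda}{a}\tilde M+kP,\quad \dot P=Q,\quad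 \dot Q=\tfrac1\lambda(\tilde M-dP^2-\tilde eP) \qquad(1)$$ and the consistency condition $$(1+\alpha^2)M=\big(\tfrac a\lambda\tilde N-\lambda Q\big)^2, \qquad(2)$$ $$M=\tfrac{d(1+\alpha^2)}{2\lambda}(dP+e)(\tilde M-dP^2-\tilde eP)-\tfrac{d^2(1+\alpha^2)}4Q^2+(\alpha\omega+\mu)(dP+e)^2-(1+\alpha\beta)(dP+e)^3 .$$ For $\rho,\gamma\in\mathbb R$ let $\Omega=\sqrt{\omega_1^2+\rho^2\gamma}$ and, with $\epsilon=\rho^2$, write $$\tilde M=\epsilon\tilde e\tilde y,\quad \tilde N=\epsilon\big(\tilde x-\tfrac{k}{\omega_1^{2}}\tilde w\big),\quad P=\epsilon(\tilde y+\tilde z),\quad Q=\epsilon\tilde w,$$ $$\tilde x=x_1,\quad \tilde y=\rho x_2,\quad \tilde z=z_1\sin\Omega\tau+z_2\cos\Omega\tau,\quad \tilde w=\Omega z_1\cos\Omega\tau-\Omega z_2\sin\Omega\tau .$$ In the variables $X=(x_1,x_2,z_1,z_2)$, with $z=\rho x_2+\tilde z$ and $y=x_1-\frac{k\lambda}{\tilde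 e}\tilde w$, system (1) becomes the rescaled system $$\dot x_1=\tfrac{\rho\lambda e}{a}x_2-\rho^2\tfrac{kd}{\tilde e}z^2,\qquad \dot x_2=\tfrac{\rho}{\tilde e}yz,\qquad(3)$$ $$\dot z_1=\tfrac{\rho^2}{\Omega}\big[-\tfrac d\lambda z^2\cos\Omega\tau+\gamma\tilde z\cos\Omega\tau-\tfrac{\Omega}{\tilde e}yz\sin\Omega\tau\big],\qquad \dot z_2=\tfrac{\rho^2}{\Omega}\big[\tfrac d\lambda z^2\sin\Omega\tau-\gamma\tilde z\sin\Omega\tau-\tfrac{\Omega}{\tilde e}yz\cos\Omega\tau\big].$$ Let $a_4\ne0$. Then the following hold. (i) At $\omega=\mu\beta$ one has $\omega_1^2>0$, the linear part of (1) at the origin has characteristic polynomial $X^2(X^2+\omega_1^2)$, and its eigenvalue $0$ has a one-dimensional eigenspace. (ii) For $(a_{22},\gamma,\omega_3)\in\mathbb R^3$ choose $\omega$ by $$e=\tfrac{\alpha\omega+\mu}{1+\alpha\beta}+\rho^2(\rho^2\omega_3-\rho\,d\,a_2),\qquad a_2=\rho a_{22}, \qquad(4)$$ and evaluate on the starting vector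 $X_0=(0,a_2,0,a_4)$ the mean over one period $2\pi/\Omega$ of the right-hand side of $\dot x_1$ (times $\rho^{-2}$), of the right-hand side of $\dot z_1$ (times $2\Omega a_4^{-1}\rho^{-2}$), and of the difference of the two sides of (2), left minus right (times $-\frac{4(1+\alpha\beta)\lambda}{(1+\alpha^2)\mu}\rho^{-4}$). As $\rho\to0$ these tend to the left-hand sides of the determining equations $$a_{22}\tfrac{\lambda e}{a}-\tfrac{k d a_4^2}{2\tilde e}=0,\qquad \gamma=0,\qquad a_4^2\big(-\lambda+d^2(1+\alpha\beta)(1+\alpha^2+\lambda+\lambda\alpha\beta)\big)+4(1+\alpha\beta)^2\lambda\mu\,\omega_3=0,$$ in which $e,\tilde e,k$ are taken at $\omega=\mu\beta$ (so $e=\mu$). These equations have exactly one solution, and their Jacobian determinant with respect to $(a_{22},\gamma,\omega_3)$ is $4(1+\alpha\beta)^2\lambda^2\mu e/a\neq0$. (iii) There are $\rho_0>0$, continuous functions $a_{22},\gamma,\omega_3$ on $(-\rho_0,\rho_0)$ whose values at $\rho=0$ solve the determining equations, and functions $X^\rho:\mathbb R\to\mathbb R^4$ depending continuously on $(\rho,\tau)$,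 such that for every $|\rho|<\rho_0$, with $\omega=\omega(\rho)$ given by (4) and $\Omega=\Omega(\rho)$: - $\omega_1^2>0$, $\Omega>0$, and the eigenvalue $0$ of the linear part of (1) has a one-dimensional eigenspace; - $X^\rho$ is a $2\pi/\Omega$-periodic solution of (3) with mean $(0,\rho a_{22},0,a_4)$, with $x_1,z_1$ odd and $x_2,z_2$ even; - the corresponding $(\tilde M,\tilde N,P,Q)$ is a $2\pi/\Omega$-periodic solution of (1), with $\tilde M,P$ even and $\tilde N,Q$ odd, and it satisfies (2) exactly; - $dP+e>0$, and $R=\sqrt{dP+e}$, $\phi(x)=\int_0^x\frac{G}{R^2}$ with $G=\frac{(a/\lambda)\tilde N-\lambda Q}{1+\alpha^2}$, are smooth, even, $2\pi/\Omega$-periodic, and satisfy (with $G=\phi_xR^2$) $$(1+\alpha^2)G_x=(\beta-\alpha)R^4-(\omega-\mu\alpha)R^2,\quad (1+\alpha^2)G^2=(1+\alpha^2)R^3R_{xx}+(\alpha\omega+\mu)R^4-(1+\alpha\beta)R^6;$$ - if $\rho\ne0$, then $R$ is not constant and $A(x,t)=R(x)e^{i\phi(x)-i\omega t}$ is a stationary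 modulated amplitude wave: a classical solution of the CGLe, $2\pi/\Omega$-periodic in $x$. (iv) The waves bifurcate from the homogeneously oscillating state $\sqrt\mu\,e^{-i\mu\beta t}$: as $\rho\to0$, uniformly in space, $X^\rho\to(0,0,0,a_4)$, $R\to\sqrt\mu$, $\phi\to0$ and $\phi_x\to0$, while $\omega\to\mu\beta$, $e\to\mu$ and $\Omega\to\sqrt{-2\mu(1+\alpha\beta)/(1+\alpha^2)}$. -/

import Mathlib

namespace CGL

noncomputable section

/-! ### The complex Ginzburg-Landau equation and stationary modulated amplitude waves -/

/-- `A` (arguments: space `x`, time `t`) is a classical solution on the line of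
`A_t = μ A + (1 + iα) A_xx - (1 + iβ) |A|² A`. -/
def SolvesCGL (μ α β : ℝ) (A : ℝ → ℝ → ℂ) : Prop :=
  ContDiff ℝ 2 (fun p : ℝ × ℝ => A p.1 p.2) ∧
  ∀ x t : ℝ, deriv (fun s => A x s) t =
    (μ : ℂ) * A x t
      + (1 + Complex.I * (α : ℂ)) * iteratedDeriv 2 (fun y => A y t) x
      - (1 + Complex.I * (β : ℂ)) * ((‖A x t‖ ^ 2 : ℝ) : ℂ) * A x t

/-- The coherent field `A(x,t) = R(x) exp(iφ(x) - iωt)`. -/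
def field (ω : ℝ) (R φ : ℝ → ℝ) (x t : ℝ) : ℂ :=
  (R x : ℂ) * Complex.exp (Complex.I * (φ x : ℂ) - Complex.I * (ω : ℂ) * (t : ℂ))

/-- The "angular momentum" `G = φ_x R²`. -/
def angMom (R φ : ℝ → ℝ) (x : ℝ) : ℝ := deriv φ x * R x ^ 2

/-- The stationary equations for amplitude and phase:
`(1+α²) G_x = (β-α) R⁴ - (ω-μα) R²` and
`(1+α²) G² = (1+α²) R³ R_xx + (αω+μ) R⁴ - (1+αβ) R⁶`. -/
def SolvesAmplitudePhase (μ α β ω : ℝ) (R φ : ℝ → ℝ) : Prop :=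
  ContDiff ℝ ((⊤ : ℕ∞) : WithTop ℕ∞) R ∧ ContDiff ℝ ((⊤ : ℕ∞) : WithTop ℕ∞) φ ∧
  ∀ x : ℝ,
    (1 + α ^ 2) * deriv (angMom R φ) x = (β - α) * R x ^ 4 - (ω - μ * α) * R x ^ 2 ∧
    (1 + α ^ 2) * angMom R φ x ^ 2 =
      (1 + α ^ 2) * R x ^ 3 * iteratedDeriv 2 R x + (α * ω + μ) * R x ^ 4
        - (1 + α * β) * R x ^ 6

/-- A stationary modulated amplitude wave of the CGLe in the periodic box of length `L`: a field
`R(x) exp(iφ(x) - iωt)` with smooth `L`-periodic positive non-constant amplitude and smooth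
phase, `L`-periodic in `x` and solving the CGLe. -/
structure IsStationaryMAW (μ α β L ω : ℝ) (R φ : ℝ → ℝ) : Prop where
  L_pos : 0 < L
  smooth_R : ContDiff ℝ ((⊤ : ℕ∞) : WithTop ℕ∞) R
  smooth_φ : ContDiff ℝ ((⊤ : ℕ∞) : WithTop ℕ∞) φ
  R_pos : ∀ x, 0 < R x
  R_periodic : Function.Periodic R L
  R_modulated : ¬ ∃ r : ℝ, ∀ x, R x = r
  field_periodic : ∀ t, Function.Periodic (fun x => field ω R φ x t) L
  solves : SolvesCGL μ α β (field ω R φ)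

/-! ### Coefficients -/

def coefA (α β : ℝ) : ℝ := (1 + α ^ 2) ^ 2 / (4 * (β - α))

def coefB (μ α β ω : ℝ) : ℝ :=
  (1 + α ^ 2) / 2 *
    (2 * (α * ω + μ) / (β - α) - 3 * (1 + α * β) * (ω - μ * α) / (β - α) ^ 2)

def coefC (α β : ℝ) : ℝ := -(3 * (1 + α * β) * (1 + α ^ 2) / (2 * (β - α) ^ 2))

def coefD (α β : ℝ) : ℝ := 1 / (β - α)

/-- `e = (ω - μα)/(β - α)`, the squared amplitude of the Stokes wave of frequency `ω`. -/
def coefE (μ α β ω : ℝ) : ℝ := (ω - μ * α) / (β - α)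

/-- `ẽ`, fixed by `a / lam = b / ẽ`. -/
def eTilde (μ α β lam ω : ℝ) : ℝ := lam * coefB μ α β ω / coefA α β

/-- `k`, fixed by `ẽ + (a / lam) k = e`. -/
def coefK (μ α β lam ω : ℝ) : ℝ :=
  lam / coefA α β * (coefE μ α β ω - eTilde μ α β lam ω)

/-! ### The 4-D system in the variables `(M̃, Ñ, P, Q)` -/

/-- The vector field of the 4-D system
`M̃' = ÑP`, `Ñ' = (lam/a) M̃ + kP`, `P' = Q`, `Q' = (M̃ - dP² - ẽP)/lam`. -/
def vf4 (μ α β lam ω : ℝ) (Y : Fin 4 → ℝ) : Fin 4 → ℝ :=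
  ![Y 1 * Y 2,
    lam / coefA α β * Y 0 + coefK μ α β lam ω * Y 2,
    Y 3,
    1 / lam * (Y 0 - coefD α β * Y 2 ^ 2 - eTilde μ α β lam ω * Y 2)]

/-- The linear part of the 4-D system at the fixed point `0`. -/
def linPart (μ α β lam ω : ℝ) : Matrix (Fin 4) (Fin 4) ℝ :=
  !![0, 0, 0, 0;
     lam / coefA α β, 0, coefK μ α β lam ω, 0;
     0, 0, 0, 1;
     1 / lam, 0, -(eTilde μ α β lam ω) / lam, 0]

/-- The function `M = (1+α²) R³ R_xx + (αω+μ) R⁴ - (1+αβ) R⁶` in the variables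
`(M̃, Ñ, P, Q)`, with `R² = dP + e`. -/
def bigM (μ α β lam ω : ℝ) (Y : Fin 4 → ℝ) : ℝ :=
  coefD α β * (1 + α ^ 2) / (2 * lam) * (coefD α β * Y 2 + coefE μ α β ω)
      * (Y 0 - coefD α β * Y 2 ^ 2 - eTilde μ α β lam ω * Y 2)
    - coefD α β ^ 2 * (1 + α ^ 2) / 4 * Y 3 ^ 2
    + (α * ω + μ) * (coefD α β * Y 2 + coefE μ α β ω) ^ 2
    - (1 + α * β) * (coefD α β * Y 2 + coefE μ α β ω) ^ 3

/-- The defect `(1+α²) M - ((a/lam) Ñ - lam Q)²` of the consistency condition. -/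
def consistencyDefect (μ α β lam ω : ℝ) (Y : Fin 4 → ℝ) : ℝ :=
  (1 + α ^ 2) * bigM μ α β lam ω Y - (coefA α β / lam * Y 1 - lam * Y 3) ^ 2

/-- The amplitude `R = √(dP + e)`. -/
def amplitude (μ α β ω : ℝ) (Y : ℝ → Fin 4 → ℝ) (x : ℝ) : ℝ :=
  Real.sqrt (coefD α β * Y x 2 + coefE μ α β ω)

/-- The phase, with `φ_x = G / R²`, `G = ((a/lam) Ñ - lam Q)/(1+α²)` and `φ(0) = 0`. -/
def phase (μ α β lam ω : ℝ) (Y : ℝ → Fin 4 → ℝ) (x : ℝ) : ℝ :=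
  ∫ s in (0 : ℝ)..x,
    (coefA α β / lam * Y s 1 - lam * Y s 3) / (1 + α ^ 2)
      / (coefD α β * Y s 2 + coefE μ α β ω)

/-! ### The rescaled system, `ε = ρ²` -/

/-- `Ω = √(ẽ/lam + ρ² γ)`, that is, `Ω² = ω₁² + εγ` with `ω₁² = ẽ/lam`. -/
def spatialFreq (μ α β lam ω ρ γ : ℝ) : ℝ :=
  Real.sqrt (eTilde μ α β lam ω / lam + ρ ^ 2 * γ)

/-- The carrier frequency `ω` for which
`e = (αω+μ)/(1+αβ) + ρ² (ρ² ω₃ - ρ d a₂)` with `a₂ = ρ a₂₂`; see `coefE_eq_iff`. -/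
def carrierFreq (μ α β ρ a₂₂ ω₃ : ℝ) : ℝ :=
  μ * β + ρ ^ 4 * (ω₃ - coefD α β * a₂₂) * ((1 + α * β) * (β - α) / (1 + α ^ 2))

theorem coefE_eq_iff {μ α β ρ a₂₂ ω₃ ω : ℝ} (hαβ : β - α ≠ 0) (hs : 1 + α * β ≠ 0) :
    coefE μ α β ω = (α * ω + μ) / (1 + α * β)
        + ρ ^ 2 * (ρ ^ 2 * ω₃ - ρ * coefD α β * (ρ * a₂₂))
      ↔ ω = carrierFreq μ α β ρ a₂₂ ω₃ := by
  have hm : (1 + α ^ 2) ≠ 0 := by positivity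
  unfold carrierFreq coefE coefD
  rw [div_eq_iff hαβ]
  have key : ω - μ * α - ((α * ω + μ) / (1 + α * β)
        + ρ ^ 2 * (ρ ^ 2 * ω₃ - ρ * (1 / (β - α)) * (ρ * a₂₂))) * (β - α)
      = (1 + α ^ 2) / (1 + α * β) * (ω - (μ * β + ρ ^ 4 * (ω₃ - 1 / (β - α) * a₂₂)
        * ((1 + α * β) * (β - α) / (1 + α ^ 2)))) := by
    field_simp
    ring
  rw [← sub_eq_zero, key, mul_eq_zero, sub_eq_zero]
  have : (1 + α ^ 2) / (1 + α * β) ≠ 0 := div_ne_zero hm hs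
  tauto

/-- The vector `(x̃, ỹ, z̃, w̃)` built from `v = (x₁, x₂, z₁, z₂)` at the point `τ`:
`x̃ = x₁`, `ỹ = ρ x₂`, `z̃ = z₁ sin Ωτ + z₂ cos Ωτ`, `w̃ = Ω z₁ cos Ωτ - Ω z₂ sin Ωτ`. -/
def rotate (ρ Ω τ : ℝ) (v : Fin 4 → ℝ) : Fin 4 → ℝ :=
  ![v 0,
    ρ * v 1,
    v 2 * Real.sin (Ω * τ) + v 3 * Real.cos (Ω * τ),
    Ω * v 2 * Real.cos (Ω * τ) - Ω * v 3 * Real.sin (Ω * τ)]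

/-- The linear change of variables `D`, with `ω₁⁻² = lam / ẽ`. -/
def changeD (μ α β lam ω : ℝ) : Matrix (Fin 4) (Fin 4) ℝ :=
  !![0, eTilde μ α β lam ω, 0, 0;
     1, 0, 0, -(coefK μ α β lam ω * (lam / eTilde μ α β lam ω));
     0, 1, 1, 0;
     0, 0, 0, 1]

/-- `(M̃, Ñ, P, Q) = ε D (x̃, ỹ, z̃, w̃)` with `ε = ρ²`. -/
def physical (μ α β lam ω ρ Ω τ : ℝ) (v : Fin 4 → ℝ) : Fin 4 → ℝ :=
  ρ ^ 2 • (changeD μ α β lam ω).mulVec (rotate ρ Ω τ v)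

/-- The right-hand side of the rescaled (standard form) system for `v = (x₁, x₂, z₁, z₂)`. -/
def rescaledVF (μ α β lam ω ρ γ Ω τ : ℝ) (v : Fin 4 → ℝ) : Fin 4 → ℝ :=
  let e := coefE μ α β ω
  let et := eTilde μ α β lam ω
  let k := coefK μ α β lam ω
  let d := coefD α β
  let S := Real.sin (Ω * τ)
  let C := Real.cos (Ω * τ)
  let zt := v 2 * S + v 3 * C
  let z := ρ * v 1 + zt
  let y := v 0 - k * (Ω * lam / et) * (v 2 * C - v 3 * S)
  ![ρ * lam * e / coefA α β * v 1 - ρ ^ 2 * k * (d / et) * z ^ 2,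
    ρ / et * y * z,
    ρ ^ 2 / Ω * (-d / lam * z ^ 2 * C + γ * zt * C - Ω / et * y * z * S),
    ρ ^ 2 / Ω * (d / lam * z ^ 2 * S - γ * zt * S - Ω / et * y * z * C)]

/-- The reflection `diag(-1, 1, -1, 1)`. -/
def reflQ : Matrix (Fin 4) (Fin 4) ℝ := Matrix.diagonal ![-1, 1, -1, 1]

/-- Mean value over `[0, T]`. -/
def mean (T : ℝ) (f : ℝ → ℝ) : ℝ := T⁻¹ * ∫ τ in (0 : ℝ)..T, f τ

/-! ### Determining equations -/

/-- The leading-order determining equations, as a map of `p = (a₂₂, γ, ω₃)`; here `e`, `ẽ`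
and `k` have their values at `ω = μβ`. -/
def determiningMap (μ α β lam a₄ : ℝ) (p : Fin 3 → ℝ) : Fin 3 → ℝ :=
  ![p 0 * (lam * coefE μ α β (μ * β) / coefA α β)
      - coefK μ α β lam (μ * β) * coefD α β * a₄ ^ 2 / (2 * eTilde μ α β lam (μ * β)),
    p 1,
    a₄ ^ 2 * (-lam + coefD α β ^ 2 * (1 + α * β) * (1 + α ^ 2 + lam + lam * α * β))
      + 4 * (1 + α * β) ^ 2 * lam * μ * p 2]

/-- The exact determining functions evaluated on the starting vector `X₀ = (0, ρ a₂₂, 0, a₄)`,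
normalized: the means over a period `2π/Ω` of the first and third components of the rescaled
vector field, and the mean defect of the consistency condition. -/
def startingMap (μ α β lam a₄ ρ : ℝ) (p : Fin 3 → ℝ) : Fin 3 → ℝ :=
  let ω := carrierFreq μ α β ρ (p 0) (p 2)
  let Ω := spatialFreq μ α β lam ω ρ (p 1)
  let T := 2 * Real.pi / Ω
  let X₀ : Fin 4 → ℝ := ![0, ρ * p 0, 0, a₄]
  ![(ρ ^ 2)⁻¹ * mean T (fun τ => rescaledVF μ α β lam ω ρ (p 1) Ω τ X₀ 0),
    2 * Ω / a₄ * (ρ ^ 2)⁻¹ * mean T (fun τ => rescaledVF μ α β lam ω ρ (p 1) Ω τ X₀ 2),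
    -(4 * (1 + α * β) * lam / ((1 + α ^ 2) * μ)) * (ρ ^ 4)⁻¹
      * mean T (fun τ => consistencyDefect μ α β lam ω (physical μ α β lam ω ρ Ω τ X₀))]

end

end CGL

/-!
Write `ε = ρ²` and look for `P = ε (amplitude · cos + ε r)`. Integrating the rescaled system in this
form turns the search for an even periodic solution with prescribed means into a fixed point problem
for continuous functions on the circle, whose map is constant at `ε = 0`; the implicit function
theorem therefore yields a branch of fixed points depending continuously on `ρ`. Each determining
equation removes one obstruction: `a₂₂` makes the mean of `Ñ'` vanish, `γ` removes the resonance,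
and `ω₃` fixes the constant in the consistency condition. The difference of the two sides
of that condition is a first integral of the system, so it vanishes identically as soon as it
vanishes at the symmetry point `τ = 0`.
-/

namespace CGL

noncomputable section

/-! ### Continuous functions on the circle -/

instance : CompactSpace Real.Angle :=
  have : Fact (0 < 2 * Real.pi) := ⟨Real.two_pi_pos⟩
  inferInstanceAs (CompactSpace (AddCircle (2 * Real.pi)))

/-- The Banach algebra of continuous `2π`-periodic functions, in which the profiles of the waves
are sought. -/
abbrev PerFun : Type := C(Real.Angle, ℝ)

theorem even_sub {X Y : Type*} [Neg X] [Sub Y] {f g : X → Y} (hf : f.Even) (hg : g.Even) :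
    (f - g).Even := fun x => by
  simp only [Pi.sub_apply, hf x, hg x]

theorem odd_sub {X Y : Type*} [Neg X] [AddCommGroup Y] {f g : X → Y} (hf : f.Odd) (hg : g.Odd) :
    (f - g).Odd := fun x => by
  simp only [Pi.sub_apply, hf x, hg x, neg_sub_neg, neg_sub]

namespace PerFun

variable {f f' g g' : PerFun}

theorem continuous_line (f : PerFun) : Continuous (fun θ : ℝ => f θ) :=
  f.continuous.comp Real.Angle.continuous_coe

theorem periodic_line (f : PerFun) : Function.Periodic (fun θ : ℝ => f θ) (2 * Real.pi) :=
  fun θ => by simp only [Real.Angle.coe_add, Real.Angle.coe_two_pi, add_zero]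

theorem intervalIntegrable_line (f : PerFun) (a b : ℝ) :
    IntervalIntegrable (fun θ : ℝ => f θ) MeasureTheory.volume a b :=
  f.continuous_line.intervalIntegrable a b

theorem ext_line (h : ∀ θ : ℝ, f θ = g θ) : f = g :=
  ContinuousMap.ext fun x => x.induction_on h

theorem norm_le_of_Icc {K : ℝ} (hK : 0 ≤ K)
    (h : ∀ θ ∈ Set.Icc (0 : ℝ) (2 * Real.pi), |f θ| ≤ K) : ‖f‖ ≤ K := by
  have : Fact (0 < 2 * Real.pi) := ⟨Real.two_pi_pos⟩
  refine (ContinuousMap.norm_le _ hK).mpr fun x => ?_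
  obtain ⟨θ, hθ, rfl⟩ := AddCircle.eq_coe_Ico (p := 2 * Real.pi) x
  exact h θ ⟨hθ.1, hθ.2.le⟩

/-- The cosine as an element of `PerFun`. -/
def cos : PerFun := ⟨Real.Angle.cos, Real.Angle.continuous_cos⟩

/-- The sine as an element of `PerFun`. -/
def sin : PerFun := ⟨Real.Angle.sin, Real.Angle.continuous_sin⟩

@[simp] theorem cos_apply (x : Real.Angle) : cos x = x.cos := rfl

@[simp] theorem sin_apply (x : Real.Angle) : sin x = x.sin := rfl

theorem even_cos : Function.Even cos := Real.Angle.cos_neg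

theorem odd_sin : Function.Odd sin := Real.Angle.sin_neg

theorem even_one : Function.Even (1 : PerFun) := fun _ => rfl

theorem cos_mul_cos_add_sin_mul_sin : cos * cos + sin * sin = 1 := by
  ext x
  simpa [sq] using x.cos_sq_add_sin_sq

/-! ### Mean value and differentiation -/

/-- The mean value of a periodic function. -/
def avg : PerFun →L[ℝ] ℝ :=
  LinearMap.mkContinuous
    { toFun := fun f => (2 * Real.pi)⁻¹ * ∫ θ in (0 : ℝ)..(2 * Real.pi), f θ
      map_add' := fun f g => by
        simp only [ContinuousMap.add_apply]
        rw [intervalIntegral.integral_add (f.intervalIntegrable_line _ _)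
          (g.intervalIntegrable_line _ _), mul_add]
      map_smul' := fun c f => by
        simp only [ContinuousMap.smul_apply, smul_eq_mul, RingHom.id_apply,
          intervalIntegral.integral_const_mul]
        ring } 1
    (fun f => by
      have h := intervalIntegral.norm_integral_le_of_norm_le_const (a := 0) (b := 2 * Real.pi)
        (f := fun θ : ℝ => f θ) fun θ _ => f.norm_coe_le_norm θ
      rw [sub_zero, mul_comm ‖f‖] at h
      rw [one_mul, LinearMap.coe_mk, AddHom.coe_mk, norm_mul, norm_inv,
        inv_mul_le_iff₀ (norm_pos_iff.mpr Real.two_pi_pos.ne')]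
      exact h)

theorem avg_apply (f : PerFun) : avg f = (2 * Real.pi)⁻¹ * ∫ θ in (0 : ℝ)..(2 * Real.pi), f θ :=
  rfl

theorem abs_avg_le (f : PerFun) : |avg f| ≤ ‖f‖ := by
  simpa using avg.le_of_opNorm_le (LinearMap.mkContinuous_norm_le _ zero_le_one _) f

@[simp] theorem avg_one : avg 1 = 1 := by
  rw [avg_apply]
  simp only [ContinuousMap.one_apply, intervalIntegral.integral_const, sub_zero, smul_eq_mul,
    mul_one, inv_mul_cancel₀ Real.two_pi_pos.ne']

theorem avg_eq_zero_of_odd (hf : Function.Odd f) : avg f = 0 := by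
  have h1 := intervalIntegral.integral_comp_neg (a := 0) (b := 2 * Real.pi) (fun θ : ℝ => f θ)
  have h2 := f.periodic_line.intervalIntegral_add_eq (-(2 * Real.pi)) 0
  simp only [Real.Angle.coe_neg, hf _, intervalIntegral.integral_neg, neg_zero, neg_add_cancel,
    zero_add] at h1 h2
  rw [avg_apply, show ∫ θ in (0 : ℝ)..(2 * Real.pi), f θ = 0 by linarith, mul_zero]

/-- `f'` is the derivative of `f`, both viewed as `2π`-periodic functions on the line. -/
def HasDeriv (f f' : PerFun) : Prop :=
  ∀ θ : ℝ, HasDerivAt (fun t : ℝ => f t) (f' θ) θ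

namespace HasDeriv

theorem add (hf : HasDeriv f f') (hg : HasDeriv g g') : HasDeriv (f + g) (f' + g') :=
  fun θ => (hf θ).add (hg θ)

theorem sub (hf : HasDeriv f f') (hg : HasDeriv g g') : HasDeriv (f - g) (f' - g') :=
  fun θ => (hf θ).sub (hg θ)

theorem mul (hf : HasDeriv f f') (hg : HasDeriv g g') : HasDeriv (f * g) (f' * g + f * g') :=
  fun θ => (hf θ).mul (hg θ)

theorem congr_deriv (hf : HasDeriv f f') (h : f' = g') : HasDeriv f g' := h ▸ hf

theorem const_smul (hf : HasDeriv f f') (c : ℝ) : HasDeriv (c • f) (c • f') :=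
  fun θ => (hf θ).const_mul c

theorem avg_eq_zero (hf : HasDeriv f f') : avg f' = 0 := by
  rw [avg_apply, intervalIntegral.integral_eq_sub_of_hasDerivAt (fun θ _ => hf θ)
    (f'.intervalIntegrable_line _ _), Real.Angle.coe_two_pi, Real.Angle.coe_zero, sub_self,
    mul_zero]

theorem unique (hf : HasDeriv f f') (hg : HasDeriv g f') (h0 : f 0 = g 0) : f = g := by
  refine ext_line fun θ => sub_eq_zero.mp ?_
  have hconst := is_const_of_deriv_eq_zero (𝕜 := ℝ) (f := fun θ : ℝ => f θ - g θ)
    (fun θ => ((hf θ).sub (hg θ)).differentiableAt)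
    (fun θ => ((hf θ).sub (hg θ)).deriv.trans (sub_self _)) θ 0
  simpa only [Real.Angle.coe_zero, h0, sub_self] using hconst

end HasDeriv

theorem hasDeriv_const (a : ℝ) : HasDeriv (a • 1) 0 := fun θ => hasDerivAt_const θ (a * 1)

theorem hasDeriv_cos : HasDeriv cos (-sin) := Real.hasDerivAt_cos

theorem hasDeriv_sin : HasDeriv sin cos := Real.hasDerivAt_sin

@[simp] theorem avg_cos : avg cos = 0 := hasDeriv_sin.avg_eq_zero

theorem avg_cos_mul_cos : avg (cos * cos) = 1 / 2 := by
  have h1 := (hasDeriv_sin.mul hasDeriv_cos).avg_eq_zero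
  have h2 := congrArg avg cos_mul_cos_add_sin_mul_sin
  simp only [map_add, mul_neg, map_neg, avg_one] at h1 h2
  linarith

theorem avg_sin_mul_sin : avg (sin * sin) = 1 / 2 := by
  have h := congrArg avg cos_mul_cos_add_sin_mul_sin
  rw [map_add, avg_one, avg_cos_mul_cos] at h
  linarith

theorem avg_cos_mul_sin_mul_sin : avg (cos * (sin * sin)) = 0 := by
  have h := (hasDeriv_sin.mul (hasDeriv_sin.mul hasDeriv_sin)).avg_eq_zero
  rw [show cos * (sin * sin) + sin * (cos * sin + sin * cos) = (3 : ℝ) • (cos * (sin * sin)) by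
    ext; simp; ring, map_smul, smul_eq_mul] at h
  linarith

theorem avg_cos_mul_cos_mul_cos : avg (cos * (cos * cos)) = 0 := by
  rw [eq_sub_of_add_eq cos_mul_cos_add_sin_mul_sin, mul_sub, mul_one, map_sub, avg_cos,
    avg_cos_mul_sin_mul_sin, sub_zero]

/-! ### Primitives -/

theorem integral_sub_avg (f : PerFun) :
    ∫ t in (0 : ℝ)..(2 * Real.pi), (f - avg f • (1 : PerFun)) t = 0 := by
  have h : avg (f - avg f • (1 : PerFun)) = 0 := by simp
  exact (mul_eq_zero.mp h).resolve_left (inv_ne_zero Real.two_pi_pos.ne')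

theorem periodic_integral_sub_avg (f : PerFun) :
    Function.Periodic (fun θ : ℝ => ∫ t in (0 : ℝ)..θ, (f - avg f • (1 : PerFun)) t)
      (2 * Real.pi) := fun θ => by
  have h := (periodic_line (f - avg f • (1 : PerFun))).intervalIntegral_add_eq_add 0 θ
    (intervalIntegrable_line _)
  simpa only [zero_add, integral_sub_avg, add_zero, add_comm θ] using h

theorem abs_integral_sub_avg_le (f : PerFun) {θ : ℝ} (hθ : θ ∈ Set.Icc 0 (2 * Real.pi)) :
    |∫ t in (0 : ℝ)..θ, (f - avg f • (1 : PerFun)) t| ≤ 2 * Real.pi * 2 * ‖f‖ := by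
  have hbound : ∀ t : ℝ, ‖(f - avg f • (1 : PerFun)) t‖ ≤ 2 * ‖f‖ := fun t => by
    have h := (abs_sub (f t) (avg f)).trans (add_le_add (f.norm_coe_le_norm t) (abs_avg_le f))
    simpa [two_mul] using h
  have h := intervalIntegral.norm_integral_le_of_norm_le_const fun t (_ : t ∈ Set.uIoc 0 θ) =>
    hbound t
  rw [sub_zero, abs_of_nonneg hθ.1] at h
  refine h.trans ?_
  nlinarith [hθ.2, norm_nonneg f]

/-- The primitive of `f - avg f` that vanishes at `0`. -/
def prim : PerFun →L[ℝ] PerFun :=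
  LinearMap.mkContinuous
    { toFun := fun f => ⟨(periodic_integral_sub_avg f).lift, continuous_coinduced_dom.mpr
        (intervalIntegral.continuous_primitive
          (intervalIntegrable_line (f - avg f • (1 : PerFun))) 0)⟩
      map_add' := fun f g => by
        refine ext_line fun θ => ?_
        change ∫ t in (0 : ℝ)..θ, (_ : ℝ) = (∫ t in (0 : ℝ)..θ, _) + ∫ t in (0 : ℝ)..θ, _
        rw [← intervalIntegral.integral_add (intervalIntegrable_line _ _ _)
          (intervalIntegrable_line _ _ _)]
        refine intervalIntegral.integral_congr fun t _ => ?_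
        simp only [map_add, ContinuousMap.sub_apply, ContinuousMap.add_apply,
          ContinuousMap.smul_apply, ContinuousMap.one_apply, smul_eq_mul]
        ring
      map_smul' := fun c f => by
        refine ext_line fun θ => ?_
        change ∫ t in (0 : ℝ)..θ, (_ : ℝ) = c * ∫ t in (0 : ℝ)..θ, _
        rw [← intervalIntegral.integral_const_mul]
        refine intervalIntegral.integral_congr fun t _ => ?_
        simp only [map_smul, ContinuousMap.sub_apply, ContinuousMap.smul_apply,
          ContinuousMap.one_apply, smul_eq_mul]
        ring }
    (2 * Real.pi * 2)
    (fun f => norm_le_of_Icc (by positivity) fun _ hθ => abs_integral_sub_avg_le f hθ)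

theorem prim_line (f : PerFun) (θ : ℝ) :
    prim f θ = ∫ t in (0 : ℝ)..θ, (f - avg f • (1 : PerFun)) t := rfl

@[simp] theorem prim_zero (f : PerFun) : prim f 0 = 0 := by
  rw [← Real.Angle.coe_zero, prim_line, intervalIntegral.integral_same]

theorem hasDeriv_prim (f : PerFun) : HasDeriv (prim f) (f - avg f • 1) := fun θ =>
  ((f - avg f • (1 : PerFun)).continuous_line.integral_hasStrictDerivAt 0 θ).hasDerivAt

theorem hasDeriv_prim_of_avg_eq_zero (hf : avg f = 0) : HasDeriv (prim f) f := by
  simpa only [hf, zero_smul, sub_zero] using hasDeriv_prim f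

theorem prim_neg_line (f : PerFun) (θ : ℝ) :
    prim f (-θ : ℝ) = -∫ t in (0 : ℝ)..θ, (f - avg f • (1 : PerFun)) (-t : ℝ) := by
  rw [intervalIntegral.integral_comp_neg (fun t : ℝ => (f - avg f • (1 : PerFun)) t), neg_zero,
    ← intervalIntegral.integral_symm, prim_line]

theorem odd_prim (hf : Function.Even f) : Function.Odd (prim f) := fun x => by
  induction x using Real.Angle.induction_on with
  | _ θ =>
    rw [← Real.Angle.coe_neg, prim_neg_line, prim_line]
    simp only [Real.Angle.coe_neg, ContinuousMap.sub_apply, ContinuousMap.smul_apply,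
      ContinuousMap.one_apply, hf _]

theorem even_prim (hf : Function.Odd f) : Function.Even (prim f) := fun x => by
  induction x using Real.Angle.induction_on with
  | _ θ =>
    rw [← Real.Angle.coe_neg, prim_neg_line, prim_line]
    simp only [Real.Angle.coe_neg, avg_eq_zero_of_odd hf, zero_smul, sub_zero, hf _,
      intervalIntegral.integral_neg, neg_neg]

/-- The even part of a function. Precomposing the solution operators below with it makes their
values even or odd without any hypothesis on the argument. -/
def evenPart : PerFun →L[ℝ] PerFun :=
  (2⁻¹ : ℝ) • (ContinuousLinearMap.id ℝ PerFun
    + ContinuousLinearMap.mk (LinearMap.mk ⟨fun f => f.comp ⟨Neg.neg, continuous_neg⟩,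
        fun _ _ => rfl⟩ fun _ _ => rfl) (ContinuousMap.continuous_precomp _))

theorem evenPart_apply (f : PerFun) (x : Real.Angle) : evenPart f x = 2⁻¹ * (f x + f (-x)) :=
  rfl

theorem even_evenPart (f : PerFun) : Function.Even (evenPart f) := fun x => by
  rw [evenPart_apply, evenPart_apply, neg_neg, add_comm]

theorem odd_sub_evenPart (f : PerFun) : Function.Odd (f - evenPart f) := fun x => by
  simp only [ContinuousMap.sub_apply, evenPart_apply, neg_neg]
  ring

theorem evenPart_of_even (hf : Function.Even f) : evenPart f = f := by
  ext x
  rw [evenPart_apply, hf x]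
  ring

theorem evenPart_of_odd (hf : Function.Odd f) : evenPart f = 0 := by
  ext x
  rw [evenPart_apply, hf x, add_neg_cancel, mul_zero, ContinuousMap.zero_apply]

/-- The odd primitive of `f - avg f`, for even `f`. -/
def primEven : PerFun →L[ℝ] PerFun := prim.comp evenPart

/-- The primitive with mean value zero of an odd function. -/
def primOdd : PerFun →L[ℝ] PerFun :=
  (ContinuousLinearMap.id ℝ PerFun - avg.smulRight (1 : PerFun)).comp
    (prim.comp (ContinuousLinearMap.id ℝ PerFun - evenPart))

theorem primEven_apply (f : PerFun) : primEven f = prim (evenPart f) := rfl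

theorem primOdd_apply (f : PerFun) :
    primOdd f = prim (f - evenPart f) - avg (prim (f - evenPart f)) • (1 : PerFun) := rfl

theorem odd_primEven (f : PerFun) : Function.Odd (primEven f) := odd_prim (even_evenPart f)

theorem even_primOdd (f : PerFun) : Function.Even (primOdd f) :=
  even_sub (even_prim (odd_sub_evenPart f)) (even_one.const_smul _)

theorem avg_primOdd (f : PerFun) : avg (primOdd f) = 0 := by
  simp only [primOdd_apply, map_sub, map_smul, avg_one, smul_eq_mul, mul_one, sub_self]

theorem hasDeriv_primEven (hf : Function.Even f) : HasDeriv (primEven f) (f - avg f • 1) := by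
  rw [primEven_apply, evenPart_of_even hf]
  exact hasDeriv_prim f

theorem hasDeriv_primOdd (hf : Function.Odd f) : HasDeriv (primOdd f) f := by
  rw [primOdd_apply, evenPart_of_odd hf, sub_zero]
  simpa only [sub_zero] using
    (hasDeriv_prim_of_avg_eq_zero (avg_eq_zero_of_odd hf)).sub (hasDeriv_const _)

theorem primEven_cos : primEven cos = sin := by
  refine HasDeriv.unique (f' := cos) ?_ hasDeriv_sin ?_
  · simpa only [avg_cos, zero_smul, sub_zero] using hasDeriv_primEven even_cos
  · rw [(odd_primEven _).map_zero, odd_sin.map_zero]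

theorem primOdd_sin_mul_cos :
    primOdd (sin * cos) = (1 / 2 : ℝ) • (sin * sin) - (1 / 4 : ℝ) • 1 := by
  have hodd : Function.Odd (sin * cos) := odd_sin.mul_even even_cos
  have hprim : prim (sin * cos) = (1 / 2 : ℝ) • (sin * sin) := by
    refine (hasDeriv_prim_of_avg_eq_zero (avg_eq_zero_of_odd hodd)).unique ?_ (by simp)
    convert (hasDeriv_sin.mul hasDeriv_sin).const_smul (1 / 2) using 1
    rw [mul_comm cos, ← two_smul ℝ, smul_smul]
    norm_num
  rw [primOdd_apply, evenPart_of_odd hodd, sub_zero, hprim, map_smul, avg_sin_mul_sin]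
  norm_num

/-! ### The resonant oscillator -/

/-- Variation of constants for `r'' + r = f`: a solution when `f` is even with
`avg (cos * f) = 0`. -/
def oscRaw : PerFun →L[ℝ] PerFun :=
  (ContinuousLinearMap.mul ℝ PerFun sin).comp
      (prim.comp ((ContinuousLinearMap.mul ℝ PerFun cos).comp evenPart))
    - (ContinuousLinearMap.mul ℝ PerFun cos).comp
      (prim.comp ((ContinuousLinearMap.mul ℝ PerFun sin).comp evenPart))

/-- The derivative of `oscRaw f`. -/
def oscRawDeriv : PerFun →L[ℝ] PerFun :=
  (ContinuousLinearMap.mul ℝ PerFun cos).comp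
      (prim.comp ((ContinuousLinearMap.mul ℝ PerFun cos).comp evenPart))
    + (ContinuousLinearMap.mul ℝ PerFun sin).comp
      (prim.comp ((ContinuousLinearMap.mul ℝ PerFun sin).comp evenPart))

theorem oscRaw_apply (f : PerFun) :
    oscRaw f = sin * prim (cos * evenPart f) - cos * prim (sin * evenPart f) := rfl

theorem oscRawDeriv_apply (f : PerFun) :
    oscRawDeriv f = cos * prim (cos * evenPart f) + sin * prim (sin * evenPart f) := rfl

/-- The `cos` component of `oscRaw f`, as a functional of `f`. -/
def oscRawCoeff : PerFun →L[ℝ] ℝ :=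
  (2 : ℝ) • avg.comp ((ContinuousLinearMap.mul ℝ PerFun cos).comp oscRaw)

theorem oscRawCoeff_apply (f : PerFun) : oscRawCoeff f = 2 * avg (cos * oscRaw f) := rfl

/-- The even solution of `r'' + r = f` with `avg (cos * r) = 0`, for `f` even with
`avg (cos * f) = 0`. -/
def osc : PerFun →L[ℝ] PerFun := oscRaw - oscRawCoeff.smulRight cos

/-- The derivative of `osc f`. -/
def oscDeriv : PerFun →L[ℝ] PerFun := oscRawDeriv + oscRawCoeff.smulRight sin

theorem osc_apply (f : PerFun) : osc f = oscRaw f - oscRawCoeff f • cos := rfl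

theorem oscDeriv_apply (f : PerFun) : oscDeriv f = oscRawDeriv f + oscRawCoeff f • sin := rfl

theorem even_osc (f : PerFun) : Function.Even (osc f) := by
  have hf := even_evenPart f
  exact even_sub (even_sub (odd_sin.mul_odd (odd_prim (even_cos.mul_even hf)))
    (even_cos.mul_even (even_prim (odd_sin.mul_even hf)))) (even_cos.const_smul _)

theorem odd_oscDeriv (f : PerFun) : Function.Odd (oscDeriv f) := by
  have hf := even_evenPart f
  exact ((even_cos.mul_odd (odd_prim (even_cos.mul_even hf))).add
    (odd_sin.mul_even (even_prim (odd_sin.mul_even hf)))).add (odd_sin.const_smul _)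

theorem avg_cos_mul_osc (f : PerFun) : avg (cos * osc f) = 0 := by
  rw [osc_apply, oscRawCoeff_apply, mul_sub, mul_smul_comm, map_sub, map_smul, avg_cos_mul_cos,
    smul_eq_mul]
  ring

theorem hasDeriv_osc (hf : Function.Even f) (h0 : avg (cos * f) = 0) :
    HasDeriv (osc f) (oscDeriv f) := by
  have h1 : avg (sin * f) = 0 := avg_eq_zero_of_odd (odd_sin.mul_even hf)
  rw [osc_apply, oscDeriv_apply, oscRaw_apply, oscRawDeriv_apply, evenPart_of_even hf]
  convert ((hasDeriv_sin.mul (hasDeriv_prim_of_avg_eq_zero h0)).sub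
    (hasDeriv_cos.mul (hasDeriv_prim_of_avg_eq_zero h1))).sub
    (hasDeriv_cos.const_smul (oscRawCoeff f)) using 1
  rw [smul_neg]
  ring

theorem hasDeriv_oscDeriv (hf : Function.Even f) (h0 : avg (cos * f) = 0) :
    HasDeriv (oscDeriv f) (f - osc f) := by
  have h1 : avg (sin * f) = 0 := avg_eq_zero_of_odd (odd_sin.mul_even hf)
  rw [osc_apply, oscDeriv_apply, oscRaw_apply, oscRawDeriv_apply, evenPart_of_even hf]
  convert ((hasDeriv_cos.mul (hasDeriv_prim_of_avg_eq_zero h0)).add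
    (hasDeriv_sin.mul (hasDeriv_prim_of_avg_eq_zero h1))).add
    (hasDeriv_sin.const_smul (oscRawCoeff f)) using 1
  linear_combination -f * cos_mul_cos_add_sin_mul_sin

theorem avg_osc (hf : Function.Even f) (h0 : avg (cos * f) = 0) : avg (osc f) = avg f := by
  have h := (hasDeriv_oscDeriv hf h0).avg_eq_zero
  rw [map_sub] at h
  linarith

end PerFun

open PerFun

/-! ### The fixed point problem -/

theorem exists_fixedPoint_branch {E : Type*} [NormedAddCommGroup E] [NormedSpace ℝ E]
    [CompleteSpace E] {Φ : ℝ × E → E} {u₀ : E} (hΦ : ContDiffAt ℝ 1 Φ (0, u₀))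
    (hconst : ∀ u, Φ (0, u) = u₀) :
    ∃ u : ℝ → E, u 0 = u₀ ∧ ∀ᶠ ε in nhds (0 : ℝ), ContinuousAt u ε ∧ Φ (ε, u ε) = u ε := by
  set F : ℝ × E → E := fun z => z.2 - Φ z with hF
  have hcd : ContDiffAt ℝ 1 F (0, u₀) := contDiffAt_snd.sub hΦ
  have hpartial : (fderiv ℝ F (0, u₀)).comp (ContinuousLinearMap.inr ℝ ℝ E)
      = ContinuousLinearMap.id ℝ E := by
    refine ((hcd.differentiableAt one_ne_zero).hasFDerivAt.comp u₀
      (hasFDerivAt_prodMk_right 0 u₀)).unique ?_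
    have hslice : (F ∘ fun u : E => ((0 : ℝ), u)) = fun u => u - u₀ := by
      funext u
      simp only [Function.comp_apply, hF, hconst]
    exact hslice ▸ (hasFDerivAt_id u₀).sub_const u₀
  have hinv : ((fderiv ℝ F (0, u₀)).comp (ContinuousLinearMap.inr ℝ ℝ E)).IsInvertible :=
    hpartial ▸ ⟨ContinuousLinearEquiv.refl ℝ E, rfl⟩
  refine ⟨hcd.implicitFunction one_ne_zero hinv,
    hcd.implicitFunction_apply_self one_ne_zero hinv, ?_⟩
  filter_upwards [hcd.eventually_apply_implicitFunction one_ne_zero hinv,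
    (hcd.contDiffAt_implicitFunction one_ne_zero hinv).eventually (by simp)] with ε hε hc
  simp only [hF, hconst, sub_self] at hε
  exact ⟨hc.continuousAt, (sub_eq_zero.mp hε).symm⟩

/-- The constants of the fixed point problem: `s = 1 + αβ`, `m = 1 + α²`, the coefficients `d`,
`lam`, `a`, `μ` of the CGLe, and the amplitude `amp` of the leading mode. -/
structure Reduced where
  s : ℝ
  m : ℝ
  d : ℝ
  lam : ℝ
  a : ℝ
  μ : ℝ
  amp : ℝ

/-- The parameter `ε = ρ²` and the unknowns `(r, h, γ, σ)`, where `P = ε (amp cos θ + ε r)` and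
`M̃ = ε² h` are functions of the angle `θ = Ωτ`, and `σ = ω₃ - d a₂₂`. -/
abbrev Unknowns : Type := ℝ × (PerFun × PerFun × ℝ × ℝ)

namespace Unknowns

/-- The parameter `ε`. -/
abbrev ε (z : Unknowns) : ℝ := z.1

/-- The correction `r` in `P = ε (amp cos θ + ε r)`. -/
abbrev r (z : Unknowns) : PerFun := z.2.1

/-- The function `h = M̃ / ε²`. -/
abbrev h (z : Unknowns) : PerFun := z.2.2.1

/-- The frequency correction in `Ω² = ω₁² + εγ`. -/
abbrev γ (z : Unknowns) : ℝ := z.2.2.2.1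

/-- The carrier frequency correction `σ = ω₃ - d a₂₂`. -/
abbrev σ (z : Unknowns) : ℝ := z.2.2.2.2

end Unknowns

namespace Reduced

variable (c : Reduced) (z : Unknowns)

/-- The coefficient `e`. -/
def e : ℝ := c.μ + z.ε ^ 2 * z.σ * (c.s / c.m)

/-- The squared linear frequency `ω₁² = ẽ / lam`. -/
def ω₁Sq : ℝ := -(2 * c.s / c.m) * (c.e z + 2 * z.ε ^ 2 * z.σ)

/-- The coefficient `k`. -/
def k : ℝ := c.lam / c.a * (c.e z - c.lam * c.ω₁Sq z)

/-- The squared frequency `Ω²`. -/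
def ΩSq : ℝ := c.ω₁Sq z + z.ε * z.γ

/-- The profile `p = P / ε`. -/
def p : PerFun := c.amp • cos + z.ε • z.r

/-- The profile `n = Ω Ñ / ε`, the odd primitive of `ε (lam / a) h + k p`. -/
def n : PerFun := (z.ε * (c.lam / c.a)) • primEven z.h + c.k z • primEven (c.p z)

/-- The mean value of `h`, chosen so that the mean of `ε (lam / a) h + k p` vanishes at a fixed
point. -/
def hMean : ℝ := c.k z * c.d * c.a / (c.lam * c.e z) * avg (c.p z * c.p z)

/-- The new value of `h`: the equation `M̃' = Ñ P` integrated. -/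
def nextH : PerFun := c.hMean z • 1 + (c.ΩSq z)⁻¹ • primOdd (c.n z * c.p z)

/-- The quadratic term `(M̃ - d P²) / ε²`. -/
def quad : PerFun := c.nextH z - c.d • (c.p z * c.p z)

/-- The new value of `γ`: the solvability condition of the oscillator `r'' + r = forcing`. -/
def nextγ : ℝ :=
  -(2 / c.amp) * (z.ε * z.γ * avg (cos * z.r) + c.lam⁻¹ * avg (cos * c.quad z))

/-- The forcing of the oscillator for `r`. -/
def forcing : PerFun := (c.ΩSq z)⁻¹ • (c.lam⁻¹ • c.quad z + c.nextγ z • c.p z)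

/-- The coefficient of `cos` in `r`, fixed by the requirement that `z₂` has mean `amp`. -/
def cosCoeff : ℝ := avg (cos * c.nextH z) / (c.lam * c.ω₁Sq z)

/-- The new value of `r`. -/
def nextR : PerFun := osc (c.forcing z) + c.cosCoeff z • cos

/-- The new value of `σ`: the consistency condition at the point of symmetry `τ = 0`. -/
def nextσ : ℝ := (c.s * c.μ)⁻¹ *
  (c.d * c.m / (2 * c.lam) * ContinuousMap.evalCLM ℝ 0 (c.quad z)
    - c.s * c.d ^ 2 * ContinuousMap.evalCLM ℝ 0 (c.p z) ^ 2
    + z.ε * c.s * c.d * z.σ * ContinuousMap.evalCLM ℝ 0 (c.p z)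
    - z.ε ^ 2 * z.σ ^ 2 * c.s ^ 2 / c.m)

/-- The map whose fixed points are the even solutions of the wave problem. -/
def fixedPointMap : PerFun × PerFun × ℝ × ℝ := (c.nextR z, c.nextH z, c.nextγ z, c.nextσ z)

/-- The derivative of `p` at a fixed point. -/
def q : PerFun := z.ε • (oscDeriv (c.forcing z) - c.cosCoeff z • sin) - c.amp • sin

/-- The constants that are divided by do not vanish. -/
structure Nondeg : Prop where
  s : c.s ≠ 0
  m : c.m ≠ 0
  lam : c.lam ≠ 0
  a : c.a ≠ 0
  μ : c.μ ≠ 0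
  amp : c.amp ≠ 0

/-- Points at which no denominator vanishes. -/
structure IsRegular : Prop extends c.Nondeg where
  e : c.e z ≠ 0
  ω₁Sq : c.ω₁Sq z ≠ 0
  ΩSq : c.ΩSq z ≠ 0

/-- Regular fixed points of `fixedPointMap`. -/
structure IsFixed : Prop extends c.IsRegular z where
  fixed : c.fixedPointMap z = z.2

variable {c z}

section Smoothness

@[fun_prop] theorem contDiff_e : ContDiff ℝ 1 c.e := by unfold e; fun_prop

@[fun_prop] theorem contDiff_ω₁Sq : ContDiff ℝ 1 c.ω₁Sq := by unfold ω₁Sq; fun_prop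

@[fun_prop] theorem contDiff_k : ContDiff ℝ 1 c.k := by unfold k; fun_prop

@[fun_prop] theorem contDiff_ΩSq : ContDiff ℝ 1 c.ΩSq := by unfold ΩSq; fun_prop

@[fun_prop] theorem contDiff_p : ContDiff ℝ 1 c.p := by unfold p; fun_prop

@[fun_prop] theorem contDiff_n : ContDiff ℝ 1 c.n := by unfold n; fun_prop

namespace IsRegular

variable (hz : c.IsRegular z)

include hz

theorem contDiffAt_hMean : ContDiffAt ℝ 1 c.hMean z := by
  have h := mul_ne_zero hz.lam hz.e
  unfold hMean
  fun_prop (disch := assumption)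

theorem contDiffAt_nextH : ContDiffAt ℝ 1 c.nextH z := by
  have h := hz.contDiffAt_hMean
  have h' := hz.ΩSq
  unfold nextH
  fun_prop (disch := assumption)

theorem contDiffAt_quad : ContDiffAt ℝ 1 c.quad z := by
  have h := hz.contDiffAt_nextH
  unfold quad
  fun_prop

theorem contDiffAt_nextγ : ContDiffAt ℝ 1 c.nextγ z := by
  have h := hz.contDiffAt_quad
  unfold nextγ
  fun_prop

theorem contDiffAt_forcing : ContDiffAt ℝ 1 c.forcing z := by
  have h := hz.contDiffAt_quad
  have h' := hz.contDiffAt_nextγ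
  have h'' := hz.ΩSq
  unfold forcing
  fun_prop (disch := assumption)

theorem contDiffAt_cosCoeff : ContDiffAt ℝ 1 c.cosCoeff z := by
  have h := hz.contDiffAt_nextH
  have h' := mul_ne_zero hz.lam hz.ω₁Sq
  unfold cosCoeff
  fun_prop (disch := assumption)

theorem contDiffAt_nextR : ContDiffAt ℝ 1 c.nextR z := by
  have h := hz.contDiffAt_forcing
  have h' := hz.contDiffAt_cosCoeff
  unfold nextR
  fun_prop

theorem contDiffAt_q : ContDiffAt ℝ 1 c.q z := by
  have h := hz.contDiffAt_forcing
  have h' := hz.contDiffAt_cosCoeff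
  unfold q
  fun_prop

theorem contDiffAt_nextσ : ContDiffAt ℝ 1 c.nextσ z := by
  have h := hz.contDiffAt_quad
  unfold nextσ
  fun_prop

theorem contDiffAt_fixedPointMap : ContDiffAt ℝ 1 c.fixedPointMap z := by
  have h₁ := hz.contDiffAt_nextR
  have h₂ := hz.contDiffAt_nextH
  have h₃ := hz.contDiffAt_nextγ
  have h₄ := hz.contDiffAt_nextσ
  unfold fixedPointMap
  fun_prop

end IsRegular

end Smoothness

section AtZero

variable (u : PerFun × PerFun × ℝ × ℝ)

theorem e_zero : c.e (0, u) = c.μ := by simp [e]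

theorem ω₁Sq_zero : c.ω₁Sq (0, u) = -(2 * c.s / c.m) * c.μ := by simp [ω₁Sq, e_zero]

theorem k_zero : c.k (0, u) = c.lam / c.a * (c.μ + 2 * c.s * c.lam * c.μ / c.m) := by
  rw [k, e_zero, ω₁Sq_zero]
  ring

theorem ΩSq_zero : c.ΩSq (0, u) = -(2 * c.s / c.m) * c.μ := by simp [ΩSq, ω₁Sq_zero]

theorem p_zero : c.p (0, u) = c.amp • cos := by simp [p]

theorem n_zero : c.n (0, u) = (c.k (0, u) * c.amp) • sin := by
  simp [n, p_zero, primEven_cos, smul_smul]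

theorem hMean_zero :
    c.hMean (0, u) = c.k (0, u) * c.d * c.a / (c.lam * c.μ) * (c.amp ^ 2 / 2) := by
  rw [hMean, p_zero, e_zero, smul_mul_smul_comm, map_smul, avg_cos_mul_cos, smul_eq_mul]
  ring

theorem nextH_zero :
    c.nextH (0, u) = c.hMean (0, u) • 1 + ((c.ΩSq (0, u))⁻¹ * (c.k (0, u) * c.amp * c.amp)) •
      ((1 / 2 : ℝ) • (sin * sin) - (1 / 4 : ℝ) • 1) := by
  rw [nextH, n_zero, p_zero, smul_mul_smul_comm, map_smul, primOdd_sin_mul_cos, smul_smul]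

theorem avg_cos_mul_quad_zero : avg (cos * c.quad (0, u)) = 0 := by
  simp only [quad, nextH_zero, p_zero, mul_sub, mul_add, mul_smul_comm, smul_mul_assoc, map_sub,
    map_add, map_smul, mul_one, avg_cos_mul_sin_mul_sin, avg_cos_mul_cos_mul_cos, avg_cos,
    smul_zero, add_zero, sub_zero]

theorem nextγ_zero : c.nextγ (0, u) = 0 := by
  simp [nextγ, avg_cos_mul_quad_zero]

theorem q_zero : c.q (0, u) = -(c.amp • sin) := by simp [q]

theorem nextσ_zero : c.nextσ (0, u) = (c.s * c.μ)⁻¹ * (c.d * c.m / (2 * c.lam) *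
    (c.hMean (0, u) - (c.ΩSq (0, u))⁻¹ * c.k (0, u) * c.amp ^ 2 / 4 - c.d * c.amp ^ 2)
      - c.s * c.d ^ 2 * c.amp ^ 2) := by
  simp only [nextσ, quad, nextH_zero, p_zero, ContinuousMap.evalCLM_apply,
    ContinuousMap.add_apply, ContinuousMap.sub_apply, ContinuousMap.smul_apply,
    ContinuousMap.mul_apply, ContinuousMap.one_apply, cos_apply, sin_apply,
    Real.Angle.cos_zero, Real.Angle.sin_zero, smul_eq_mul]
  ring

theorem fixedPointMap_zero : c.fixedPointMap (0, u) = c.fixedPointMap (0, 0) := by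
  simp only [fixedPointMap, nextR, forcing, cosCoeff, quad, nextσ_zero, nextγ_zero, nextH_zero,
    hMean_zero, p_zero, k_zero, ω₁Sq_zero, ΩSq_zero]

theorem Nondeg.isRegular_zero (hc : c.Nondeg) : c.IsRegular (0, u) := by
  have hω : -(2 * c.s / c.m) * c.μ ≠ 0 := by
    simp only [ne_eq, mul_eq_zero, neg_eq_zero, div_eq_zero_iff, OfNat.ofNat_ne_zero, hc.s, hc.m,
      hc.μ, or_self, not_false_eq_true]
  exact ⟨hc, e_zero u ▸ hc.μ, ω₁Sq_zero u ▸ hω, ΩSq_zero u ▸ hω⟩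

theorem Nondeg.exists_branch (hc : c.Nondeg) :
    ∃ u : ℝ → PerFun × PerFun × ℝ × ℝ, ∀ᶠ ε in nhds (0 : ℝ),
      ContinuousAt u ε ∧ c.fixedPointMap (ε, u ε) = u ε :=
  let ⟨u, _, hu⟩ := exists_fixedPoint_branch (hc.isRegular_zero _).contDiffAt_fixedPointMap
    fixedPointMap_zero
  ⟨u, hu⟩

end AtZero

section Averages

variable (c z)

theorem even_nextH : Function.Even (c.nextH z) :=
  (even_one.const_smul _).add ((even_primOdd _).const_smul _)

theorem odd_n : Function.Odd (c.n z) :=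
  ((odd_primEven _).const_smul _).add ((odd_primEven _).const_smul _)

theorem odd_q : Function.Odd (c.q z) :=
  odd_sub ((odd_sub (odd_oscDeriv _) (odd_sin.const_smul _)).const_smul _) (odd_sin.const_smul _)

theorem avg_cos_mul_p : avg (cos * c.p z) = c.amp / 2 + z.ε * avg (cos * z.r) := by
  rw [p, mul_add, mul_smul_comm, mul_smul_comm, map_add, map_smul, map_smul, avg_cos_mul_cos,
    smul_eq_mul, smul_eq_mul]
  ring

theorem avg_p : avg (c.p z) = z.ε * avg z.r := by
  rw [p, map_add, map_smul, map_smul, avg_cos, smul_zero, zero_add, smul_eq_mul]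

theorem avg_nextH : avg (c.nextH z) = c.hMean z := by
  simp [nextH, avg_primOdd]

end Averages

/-! ### Fixed points solve the profile equations -/

namespace IsFixed

variable (hz : c.IsFixed z)

include hz

theorem r_eq : z.r = c.nextR z := congrArg Prod.fst hz.fixed.symm

theorem h_eq : z.h = c.nextH z := congrArg (fun u => u.2.1) hz.fixed.symm

theorem γ_eq : z.γ = c.nextγ z := congrArg (fun u => u.2.2.1) hz.fixed.symm

theorem σ_eq : z.σ = c.nextσ z := congrArg (fun u => u.2.2.2) hz.fixed.symm

theorem quad_eq : c.quad z = z.h - c.d • (c.p z * c.p z) := by rw [hz.h_eq, quad]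

theorem forcing_eq : c.forcing z = (c.ΩSq z)⁻¹ • (c.lam⁻¹ • c.quad z + z.γ • c.p z) := by
  rw [hz.γ_eq, forcing]

theorem even_h : Function.Even z.h := hz.h_eq ▸ c.even_nextH z

theorem even_p : Function.Even (c.p z) := by
  rw [p, hz.r_eq]
  exact (even_cos.const_smul _).add
    (((even_osc _).add (even_cos.const_smul _)).const_smul _)

theorem even_forcing : Function.Even (c.forcing z) :=
  (((even_sub (c.even_nextH z) ((hz.even_p.mul_even hz.even_p).const_smul _)).const_smul _).add
    (hz.even_p.const_smul _)).const_smul _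

theorem avg_cos_mul_forcing : avg (cos * c.forcing z) = 0 := by
  have hγ : z.γ * avg (cos * c.p z) + c.lam⁻¹ * avg (cos * c.quad z) = 0 := by
    have hamp := hz.amp
    have h : z.γ = -(2 / c.amp) * (z.ε * z.γ * avg (cos * z.r) + c.lam⁻¹ * avg (cos * c.quad z)) :=
      hz.γ_eq
    rw [avg_cos_mul_p]
    field_simp at h ⊢
    linear_combination h
  simp only [hz.forcing_eq, mul_smul_comm, mul_add, map_smul, map_add, smul_eq_mul]
  linear_combination (c.ΩSq z)⁻¹ * hγ

theorem avg_r : avg z.r = avg (c.forcing z) := by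
  rw [hz.r_eq, nextR, map_add, map_smul, avg_cos, avg_osc hz.even_forcing hz.avg_cos_mul_forcing,
    smul_zero, add_zero]

theorem lam_mul_ω₁Sq_mul_avg_r : c.lam * c.ω₁Sq z * avg z.r = avg (c.quad z) := by
  have hl := hz.lam
  have hΩ := hz.ΩSq
  have h : avg z.r * c.ΩSq z = c.lam⁻¹ * avg (c.quad z) + z.γ * (z.ε * avg z.r) := by
    rw [← c.avg_p z, hz.avg_r, hz.forcing_eq]
    simp only [map_smul, map_add, smul_eq_mul]
    field_simp
  rw [Reduced.ΩSq] at h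
  field_simp at h
  linear_combination h

theorem avg_deriv_n : z.ε * (c.lam / c.a) * avg z.h + c.k z * avg (c.p z) = 0 := by
  have hl := hz.lam
  have ha := hz.a
  have he := hz.e
  have hr : c.lam * c.ω₁Sq z * avg z.r = c.hMean z - c.d * avg (c.p z * c.p z) := by
    rw [hz.lam_mul_ω₁Sq_mul_avg_r, quad, map_sub, avg_nextH, map_smul, smul_eq_mul]
  have hh : c.hMean z * (c.lam * c.e z) = c.k z * c.d * c.a * avg (c.p z * c.p z) := by
    rw [hMean]
    field_simp
  have hk : c.k z * c.a = c.lam * (c.e z - c.lam * c.ω₁Sq z) := by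
    rw [k]
    field_simp
  have key : c.lam * c.hMean z + c.k z * c.a * avg z.r = 0 := by
    refine (mul_eq_zero.mp ?_).resolve_left (mul_ne_zero hl hz.ω₁Sq)
    linear_combination (c.k z * c.a) * hr + hh + c.hMean z * hk
  rw [hz.h_eq, avg_nextH, avg_p]
  field_simp
  linear_combination z.ε * key

theorem hasDeriv_p : HasDeriv (c.p z) (c.q z) := by
  have hosc := hasDeriv_osc hz.even_forcing hz.avg_cos_mul_forcing
  rw [p, hz.r_eq, nextR]
  convert (hasDeriv_cos.const_smul c.amp).add
    ((hosc.add (hasDeriv_cos.const_smul (c.cosCoeff z))).const_smul z.ε) using 1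
  rw [q]
  module

theorem hasDeriv_q : HasDeriv (c.q z) (z.ε • c.forcing z - c.p z) := by
  have hosc := hasDeriv_oscDeriv hz.even_forcing hz.avg_cos_mul_forcing
  rw [p, hz.r_eq, nextR, q]
  convert ((hosc.sub (hasDeriv_sin.const_smul (c.cosCoeff z))).const_smul z.ε).sub
    (hasDeriv_sin.const_smul c.amp) using 1
  module

theorem hasDeriv_h : HasDeriv z.h ((c.ΩSq z)⁻¹ • (c.n z * c.p z)) := by
  rw [hz.h_eq, nextH]
  simpa only [zero_add] using (hasDeriv_const (c.hMean z)).add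
    ((hasDeriv_primOdd ((c.odd_n z).mul_even hz.even_p)).const_smul (c.ΩSq z)⁻¹)

theorem hasDeriv_n : HasDeriv (c.n z) ((z.ε * (c.lam / c.a)) • z.h + c.k z • c.p z) := by
  rw [n]
  convert ((hasDeriv_primEven hz.even_h).const_smul (z.ε * (c.lam / c.a))).add
    ((hasDeriv_primEven hz.even_p).const_smul (c.k z)) using 1
  have h : (z.ε * (c.lam / c.a) * avg z.h + c.k z * avg (c.p z)) • (1 : PerFun) = 0 := by
    rw [hz.avg_deriv_n, zero_smul]
  refine sub_eq_zero.mp (Eq.trans ?_ h)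
  module

theorem avg_cos_mul_sub_eq_amp :
    2 * avg (cos * c.p z) - z.ε / (c.lam * c.ω₁Sq z) * avg (cos * z.h) = c.amp := by
  have h : avg (cos * z.r) = c.cosCoeff z / 2 := by
    rw [hz.r_eq, nextR, mul_add, mul_smul_comm, map_add, map_smul, avg_cos_mul_cos,
      avg_cos_mul_osc, smul_eq_mul]
    ring
  rw [avg_cos_mul_p, h, cosCoeff, hz.h_eq]
  ring

theorem avg_sin_mul_q : avg (sin * c.q z) = -avg (cos * c.p z) := by
  have h := (hasDeriv_sin.mul hz.hasDeriv_p).avg_eq_zero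
  rw [map_add] at h
  linarith

theorem consistency_at_zero :
    c.s * z.σ * (c.e z - z.ε * c.d * c.p z 0)
      = c.d * c.m / (2 * c.lam) * (z.h 0 - c.d * c.p z 0 ^ 2) - c.s * c.d ^ 2 * c.p z 0 ^ 2 := by
  have hsμ := mul_ne_zero hz.s hz.μ
  have h := hz.σ_eq
  rw [nextσ, hz.quad_eq, eq_inv_mul_iff_mul_eq₀ hsμ] at h
  simp only [ContinuousMap.evalCLM_apply, ContinuousMap.sub_apply, ContinuousMap.smul_apply,
    ContinuousMap.mul_apply, smul_eq_mul] at h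
  rw [Reduced.e]
  linear_combination h

end IsFixed

end Reduced

/-! ### The coefficients near the bifurcation point -/

section Coefficients

variable {μ α β lam : ℝ}

theorem beta_sub_alpha_ne_zero (h : 1 + α * β < 0) : β - α ≠ 0 := fun h0 => by
  rw [sub_eq_zero.mp h0] at h
  nlinarith [sq_nonneg α]

theorem one_add_sq_pos (α : ℝ) : 0 < 1 + α ^ 2 := by positivity

theorem coefA_eq (α β : ℝ) : coefA α β = (1 + α ^ 2) ^ 2 * coefD α β / 4 := by
  rw [coefA, coefD, div_mul_eq_div_div]
  ring

theorem coefD_ne_zero (h : β - α ≠ 0) : coefD α β ≠ 0 := one_div_ne_zero h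

theorem coefA_ne_zero (h : β - α ≠ 0) : coefA α β ≠ 0 :=
  div_ne_zero (pow_ne_zero 2 (one_add_sq_pos α).ne') (mul_ne_zero four_ne_zero h)

theorem coefC_eq (α β : ℝ) :
    coefC α β = -(3 / 2) * (1 + α * β) * (1 + α ^ 2) * coefD α β ^ 2 := by
  rw [coefC, coefD, div_pow, div_mul_eq_div_div]
  ring

theorem coefB_eq (μ α β ω : ℝ) : coefB μ α β ω = (1 + α ^ 2) / 2 * coefD α β *
    (2 * (α * ω + μ) - 3 * (1 + α * β) * coefE μ α β ω) := by
  rw [coefB, coefD, coefE, div_eq_mul_inv _ ((β - α) ^ 2), ← inv_pow]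
  ring

theorem root_ne_zero (h : β - α ≠ 0)
    (hlam : lam ^ 2 + coefC α β * lam - 2 * coefA α β * coefD α β = 0) : lam ≠ 0 := by
  rintro rfl
  refine mul_ne_zero (mul_ne_zero two_ne_zero (coefA_ne_zero h)) (coefD_ne_zero h) ?_
  linear_combination -hlam

theorem root_sq (hlam : lam ^ 2 + coefC α β * lam - 2 * coefA α β * coefD α β = 0) :
    lam ^ 2 = 3 / 2 * (1 + α * β) * (1 + α ^ 2) * coefD α β ^ 2 * lam
      + (1 + α ^ 2) ^ 2 * coefD α β ^ 2 / 2 := by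
  rw [coefC_eq, coefA_eq] at hlam
  linear_combination hlam

theorem eTilde_eq (h : β - α ≠ 0) (μ lam ω : ℝ) :
    eTilde μ α β lam ω = lam * (2 / (1 + α ^ 2)
      * (2 * (α * ω + μ) - 3 * (1 + α * β) * coefE μ α β ω)) := by
  have hd := coefD_ne_zero h
  have hm := (one_add_sq_pos α).ne'
  rw [eTilde, coefB_eq, coefA_eq]
  field_simp
  ring

/-- The carrier frequency with detuning `δ` from the bifurcation value `μβ`, scaled so that
`e = (αω + μ) / (1 + αβ) + δ`. -/
def detunedFreq (μ α β δ : ℝ) : ℝ := μ * β + δ * ((1 + α * β) * (β - α) / (1 + α ^ 2))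

/-- The squared linear frequency `ω₁²` at the detuning `δ`. -/
def linFreqSq (μ α β δ : ℝ) : ℝ :=
  -(2 * (1 + α * β) / (1 + α ^ 2)) * (coefE μ α β (detunedFreq μ α β δ) + 2 * δ)

theorem carrierFreq_eq_detunedFreq (μ α β ρ a₂₂ ω₃ : ℝ) :
    carrierFreq μ α β ρ a₂₂ ω₃ = detunedFreq μ α β (ρ ^ 4 * (ω₃ - coefD α β * a₂₂)) := rfl

@[simp] theorem detunedFreq_zero (μ α β : ℝ) : detunedFreq μ α β 0 = μ * β := by
  simp [detunedFreq]

theorem coefE_detunedFreq (h : β - α ≠ 0) (μ δ : ℝ) :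
    coefE μ α β (detunedFreq μ α β δ) = μ + δ * ((1 + α * β) / (1 + α ^ 2)) := by
  have hm := (one_add_sq_pos α).ne'
  rw [coefE, detunedFreq]
  field_simp
  ring

theorem alpha_mul_detunedFreq_add (h : β - α ≠ 0) (μ δ : ℝ) :
    α * detunedFreq μ α β δ + μ
      = (1 + α * β) * (coefE μ α β (detunedFreq μ α β δ) - δ) := by
  have hm := (one_add_sq_pos α).ne'
  rw [coefE_detunedFreq h, detunedFreq]
  field_simp
  ring

theorem eTilde_detunedFreq (h : β - α ≠ 0) (μ lam δ : ℝ) :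
    eTilde μ α β lam (detunedFreq μ α β δ) = lam * linFreqSq μ α β δ := by
  rw [eTilde_eq h, alpha_mul_detunedFreq_add h, linFreqSq]
  ring

theorem coefE_base (h : β - α ≠ 0) (μ : ℝ) : coefE μ α β (μ * β) = μ := by
  rw [← detunedFreq_zero μ α β, coefE_detunedFreq h, zero_mul, add_zero]

theorem linFreqSq_zero (h : β - α ≠ 0) (μ : ℝ) :
    linFreqSq μ α β 0 = -2 * μ * (1 + α * β) / (1 + α ^ 2) := by
  rw [linFreqSq, detunedFreq_zero, coefE_base h]
  ring

theorem eTilde_base (h : β - α ≠ 0) (μ lam : ℝ) :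
    eTilde μ α β lam (μ * β) = lam * linFreqSq μ α β 0 := by
  rw [← eTilde_detunedFreq h, detunedFreq_zero]

theorem linFreqSq_zero_pos (hμ : 0 < μ) (h : 1 + α * β < 0) : 0 < linFreqSq μ α β 0 := by
  rw [linFreqSq_zero (beta_sub_alpha_ne_zero h)]
  exact div_pos (mul_pos_of_neg_of_neg (by linarith) h) (one_add_sq_pos α)

theorem eTilde_base_div_pos {lam : ℝ} (hl : lam ≠ 0) (hμ : 0 < μ) (h : 1 + α * β < 0) :
    0 < eTilde μ α β lam (μ * β) / lam := by
  rw [eTilde_base (beta_sub_alpha_ne_zero h), mul_div_cancel_left₀ _ hl]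
  exact linFreqSq_zero_pos hμ h

theorem continuous_coefE_detunedFreq (h : β - α ≠ 0) (μ : ℝ) :
    Continuous fun δ => coefE μ α β (detunedFreq μ α β δ) := by
  simp only [coefE_detunedFreq h]
  fun_prop

theorem continuous_linFreqSq (h : β - α ≠ 0) (μ : ℝ) : Continuous (linFreqSq μ α β) := by
  have := continuous_coefE_detunedFreq h μ
  unfold linFreqSq
  fun_prop

theorem bigM_detunedFreq (h : β - α ≠ 0) (hl : lam ≠ 0) (μ ε σ hh p : ℝ) {Y : Fin 4 → ℝ}
    (h0 : Y 0 = ε ^ 2 * hh) (h2 : Y 2 = ε * p) :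
    bigM μ α β lam (detunedFreq μ α β (ε ^ 2 * σ)) Y =
      ε ^ 2 * ((coefD α β * (ε * p) + coefE μ α β (detunedFreq μ α β (ε ^ 2 * σ)))
        * (coefD α β * (1 + α ^ 2) / (2 * lam) * (hh - coefD α β * p ^ 2)
          - (1 + α * β) * coefD α β ^ 2 * p ^ 2 + (1 + α * β) * ε * coefD α β * σ * p
          - (1 + α * β) * coefE μ α β (detunedFreq μ α β (ε ^ 2 * σ)) * σ))
      - coefD α β ^ 2 * (1 + α ^ 2) / 4 * Y 3 ^ 2 := by
  have hm := (one_add_sq_pos α).ne'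
  have het : (1 + α ^ 2) / (2 * lam) * eTilde μ α β lam (detunedFreq μ α β (ε ^ 2 * σ))
      = -(1 + α * β) * (coefE μ α β (detunedFreq μ α β (ε ^ 2 * σ)) + 2 * (ε ^ 2 * σ)) := by
    rw [eTilde_detunedFreq h, linFreqSq]
    field_simp
  have hω := alpha_mul_detunedFreq_add h μ (ε ^ 2 * σ)
  rw [bigM, h0, h2]
  set e := coefE μ α β (detunedFreq μ α β (ε ^ 2 * σ))
  linear_combination (-(coefD α β) * (coefD α β * (ε * p) + e) * ε * p) * het
    + (coefD α β * (ε * p) + e) ^ 2 * hω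

end Coefficients

/-! ### The linear part -/

theorem linPart_mulVec (μ α β lam ω : ℝ) (v : Fin 4 → ℝ) :
    (linPart μ α β lam ω).mulVec v =
      ![0, lam / coefA α β * v 0 + coefK μ α β lam ω * v 2, v 3,
        1 / lam * v 0 + -(eTilde μ α β lam ω) / lam * v 2] := by
  ext i
  fin_cases i <;> simp [linPart, Matrix.mulVec, dotProduct, Fin.sum_univ_four]

theorem linPart_mulVec_eq_zero_iff {μ α β lam ω : ℝ} (hl : lam ≠ 0) (ha : coefA α β ≠ 0)
    (he : coefE μ α β ω ≠ 0) (v : Fin 4 → ℝ) :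
    (linPart μ α β lam ω).mulVec v = 0 ↔ v 0 = 0 ∧ v 2 = 0 ∧ v 3 = 0 := by
  rw [linPart_mulVec]
  constructor
  · intro hv
    have hv1 : lam / coefA α β * v 0 + coefK μ α β lam ω * v 2 = 0 := congrFun hv 1
    have hv2 : v 3 = 0 := congrFun hv 2
    have hv3 : 1 / lam * v 0 + -(eTilde μ α β lam ω) / lam * v 2 = 0 := congrFun hv 3
    have hv0 : v 0 = eTilde μ α β lam ω * v 2 := by
      field_simp at hv3
      linarith
    have hP : v 2 = 0 := by
      refine (mul_eq_zero.mp ?_).resolve_left (mul_ne_zero hl he)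
      rw [hv0, coefK] at hv1
      field_simp at hv1
      linear_combination hv1
    exact ⟨by rw [hv0, hP, mul_zero], hP, hv2⟩
  · rintro ⟨h0, h2, h3⟩
    ext i
    fin_cases i <;> simp [h0, h2, h3]

theorem finrank_eigenspace_linPart {μ α β lam ω : ℝ} (hl : lam ≠ 0) (ha : coefA α β ≠ 0)
    (he : coefE μ α β ω ≠ 0) :
    Module.finrank ℝ (Module.End.eigenspace (Matrix.toLin' (linPart μ α β lam ω)) 0) = 1 := by
  have hspan : Module.End.eigenspace (Matrix.toLin' (linPart μ α β lam ω)) 0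
      = Submodule.span ℝ {(Pi.single 1 1 : Fin 4 → ℝ)} := by
    ext v
    rw [Module.End.mem_eigenspace_iff, zero_smul, Matrix.toLin'_apply,
      linPart_mulVec_eq_zero_iff hl ha he, Submodule.mem_span_singleton]
    constructor
    · rintro ⟨h0, h2, h3⟩
      refine ⟨v 1, ?_⟩
      ext i
      fin_cases i <;> simp [h0, h2, h3]
    · rintro ⟨t, rfl⟩
      simp
  rw [hspan, finrank_span_singleton (Pi.single_ne_zero_iff.mpr one_ne_zero)]

theorem charpoly_linPart (μ α β lam ω : ℝ) :
    (linPart μ α β lam ω).charpoly =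
      Polynomial.X ^ 2 * (Polynomial.X ^ 2 + Polynomial.C (eTilde μ α β lam ω / lam)) := by
  simp [Matrix.charpoly, Matrix.charmatrix, linPart, Matrix.det_succ_row_zero,
    Fin.sum_univ_succ, Fin.succAbove, neg_div]
  ring

/-! ### Means of trigonometric polynomials -/

theorem mean_comp_mul {Ω : ℝ} (hΩ : Ω ≠ 0) (f : PerFun) :
    mean (2 * Real.pi / Ω) (fun τ => f (Ω * τ : ℝ)) = PerFun.avg f := by
  have hpi := Real.pi_ne_zero
  rw [mean, intervalIntegral.integral_comp_mul_left (fun θ : ℝ => f θ) hΩ, mul_zero,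
    mul_div_cancel₀ _ hΩ, PerFun.avg_apply, smul_eq_mul]
  field_simp

theorem mean_trig {Ω : ℝ} (hΩ : Ω ≠ 0) (c₀ c₁ c₂ c₃ c₄ c₅ : ℝ) :
    mean (2 * Real.pi / Ω) (fun τ => c₀ + c₁ * Real.cos (Ω * τ) + c₂ * Real.cos (Ω * τ) ^ 2
      + c₃ * Real.cos (Ω * τ) ^ 3 + c₄ * Real.sin (Ω * τ) ^ 2
      + c₅ * (Real.sin (Ω * τ) ^ 2 * Real.cos (Ω * τ))) = c₀ + c₂ / 2 + c₄ / 2 := by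
  open PerFun in
  have h := mean_comp_mul hΩ (c₀ • 1 + c₁ • cos + c₂ • (cos * cos) + c₃ • (cos * (cos * cos))
    + c₄ • (sin * sin) + c₅ • (cos * (sin * sin)))
  simp only [map_add, map_smul, PerFun.avg_one, PerFun.avg_cos, PerFun.avg_cos_mul_cos,
    PerFun.avg_cos_mul_cos_mul_cos, PerFun.avg_sin_mul_sin, PerFun.avg_cos_mul_sin_mul_sin,
    smul_eq_mul] at h
  rw [show c₀ + c₂ / 2 + c₄ / 2 = c₀ * 1 + c₁ * 0 + c₂ * (1 / 2) + c₃ * 0 + c₄ * (1 / 2)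
    + c₅ * 0 by ring, ← h]
  congr 1 with τ
  simp only [ContinuousMap.add_apply, ContinuousMap.smul_apply, ContinuousMap.mul_apply,
    ContinuousMap.one_apply, PerFun.cos_apply, PerFun.sin_apply, Real.Angle.cos_coe,
    Real.Angle.sin_coe, smul_eq_mul]
  ring

theorem mean_cubic {Ω : ℝ} (hΩ : Ω ≠ 0) (q A c₀ c₁ c₂ c₃ c₄ : ℝ) :
    mean (2 * Real.pi / Ω) (fun τ => c₀ + c₁ * (q + A * Real.cos (Ω * τ))
      + c₂ * (q + A * Real.cos (Ω * τ)) ^ 2 + c₃ * (q + A * Real.cos (Ω * τ)) ^ 3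
      + c₄ * Real.sin (Ω * τ) ^ 2)
      = c₀ + c₁ * q + c₂ * (q ^ 2 + A ^ 2 / 2) + c₃ * (q ^ 3 + 3 * q * A ^ 2 / 2) + c₄ / 2 := by
  have h := mean_trig hΩ (c₀ + c₁ * q + c₂ * q ^ 2 + c₃ * q ^ 3)
    (c₁ * A + 2 * c₂ * q * A + 3 * c₃ * q ^ 2 * A) (c₂ * A ^ 2 + 3 * c₃ * q * A ^ 2) (c₃ * A ^ 3)
    c₄ 0
  refine Eq.trans (congrArg _ ?_) (h.trans (by ring))
  funext τ
  ring

/-! ### The determining equations -/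

/-- The diagonal of the linear part of `determiningMap`. -/
def determiningDiag (μ α β lam : ℝ) : Fin 3 → ℝ :=
  ![lam * coefE μ α β (μ * β) / coefA α β, 1, 4 * (1 + α * β) ^ 2 * lam * μ]

/-- The constant term of `determiningMap`. -/
def determiningConst (μ α β lam a₄ : ℝ) : Fin 3 → ℝ :=
  ![-(coefK μ α β lam (μ * β) * coefD α β * a₄ ^ 2 / (2 * eTilde μ α β lam (μ * β))), 0,
    a₄ ^ 2 * (-lam + coefD α β ^ 2 * (1 + α * β) * (1 + α ^ 2 + lam + lam * α * β))]

theorem determiningMap_eq (μ α β lam a₄ : ℝ) : determiningMap μ α β lam a₄ = fun p =>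
    Matrix.toLin' (Matrix.diagonal (determiningDiag μ α β lam)) p
      + determiningConst μ α β lam a₄ := by
  funext p i
  fin_cases i <;>
    simp [determiningMap, determiningDiag, determiningConst, Matrix.mulVec_diagonal] <;> ring

theorem hasFDerivAt_determiningMap (μ α β lam a₄ : ℝ) (p : Fin 3 → ℝ) :
    HasFDerivAt (determiningMap μ α β lam a₄) (LinearMap.toContinuousLinearMap
      (Matrix.toLin' (Matrix.diagonal (determiningDiag μ α β lam)))) p := by
  rw [determiningMap_eq]
  exact (LinearMap.toContinuousLinearMap _).hasFDerivAt.add_const _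

theorem prod_determiningDiag (μ α β lam : ℝ) : ∏ i, determiningDiag μ α β lam i =
    4 * (1 + α * β) ^ 2 * lam ^ 2 * μ * coefE μ α β (μ * β) / coefA α β := by
  rw [Fin.prod_univ_three]
  simp only [determiningDiag, Matrix.cons_val]
  ring

theorem determiningDiag_ne_zero {μ α β lam : ℝ} (h : β - α ≠ 0) (hμ : μ ≠ 0)
    (hs : 1 + α * β ≠ 0) (hl : lam ≠ 0) (i : Fin 3) : determiningDiag μ α β lam i ≠ 0 := by
  have ha := coefA_ne_zero h
  fin_cases i <;> simp [determiningDiag, coefE_base h, ha, hμ, hs, hl]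

theorem det_fderiv_determiningMap (μ α β lam a₄ : ℝ) (p : Fin 3 → ℝ) :
    (fderiv ℝ (determiningMap μ α β lam a₄) p).det =
      4 * (1 + α * β) ^ 2 * lam ^ 2 * μ * coefE μ α β (μ * β) / coefA α β := by
  rw [(hasFDerivAt_determiningMap μ α β lam a₄ p).fderiv, ContinuousLinearMap.det,
    LinearMap.coe_toContinuousLinearMap, LinearMap.det_toLin', Matrix.det_diagonal,
    prod_determiningDiag]

theorem existsUnique_determiningMap {μ α β lam : ℝ} (a₄ : ℝ)
    (h : ∀ i, determiningDiag μ α β lam i ≠ 0) :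
    ∃! p : Fin 3 → ℝ, determiningMap μ α β lam a₄ p = 0 := by
  have key : ∀ p, determiningMap μ α β lam a₄ p = 0 ↔
      p = -determiningConst μ α β lam a₄ / determiningDiag μ α β lam := fun p => by
    rw [determiningMap_eq, funext_iff, funext_iff]
    refine forall_congr' fun i => ?_
    rw [Pi.div_apply, eq_div_iff (h i)]
    simp only [Matrix.toLin'_apply, Pi.add_apply, Matrix.mulVec_diagonal, Pi.zero_apply,
      Pi.neg_apply]
    rw [mul_comm (p i), eq_neg_iff_add_eq_zero]
  simp only [key, existsUnique_eq]

/-! ### The means on the starting vector -/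

section Starting

variable {μ α β lam a₄ : ℝ}

theorem physical_eq (μ α β lam ω ρ Ω τ : ℝ) (v : Fin 4 → ℝ) :
    physical μ α β lam ω ρ Ω τ v =
      ![ρ ^ 2 * (eTilde μ α β lam ω * (ρ * v 1)),
        ρ ^ 2 * (v 0 - coefK μ α β lam ω * (lam / eTilde μ α β lam ω)
          * (Ω * v 2 * Real.cos (Ω * τ) - Ω * v 3 * Real.sin (Ω * τ))),
        ρ ^ 2 * (ρ * v 1 + (v 2 * Real.sin (Ω * τ) + v 3 * Real.cos (Ω * τ))),
        ρ ^ 2 * (Ω * v 2 * Real.cos (Ω * τ) - Ω * v 3 * Real.sin (Ω * τ))] := by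
  funext i
  fin_cases i <;> simp [physical, changeD, rotate] <;> ring_nf <;> tauto

theorem mean_rescaledVF_zero {Ω : ℝ} (hΩ : Ω ≠ 0) (ω ρ γ a : ℝ) :
    mean (2 * Real.pi / Ω) (fun τ => rescaledVF μ α β lam ω ρ γ Ω τ ![0, ρ * a, 0, a₄] 0)
      = ρ ^ 2 * (a * (lam * coefE μ α β ω / coefA α β)
        - coefK μ α β lam ω * (coefD α β / eTilde μ α β lam ω)
          * (ρ ^ 4 * a ^ 2 + a₄ ^ 2 / 2)) := by
  have h := mean_cubic hΩ (ρ ^ 2 * a) a₄ (ρ ^ 2 * (a * (lam * coefE μ α β ω / coefA α β))) 0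
    (-(ρ ^ 2 * coefK μ α β lam ω * (coefD α β / eTilde μ α β lam ω))) 0 0
  refine Eq.trans (congrArg _ ?_) (h.trans (by ring))
  funext τ
  simp only [rescaledVF, Matrix.cons_val]
  ring

theorem mean_rescaledVF_two {Ω : ℝ} (hΩ : Ω ≠ 0) (ω ρ γ a : ℝ) :
    mean (2 * Real.pi / Ω) (fun τ => rescaledVF μ α β lam ω ρ γ Ω τ ![0, ρ * a, 0, a₄] 2)
      = ρ ^ 2 / Ω * (a₄ / 2) * (γ - ρ ^ 2 * (2 * coefD α β / lam * a
        + Ω ^ 2 * lam * coefK μ α β lam ω / eTilde μ α β lam ω ^ 2 * a)) := by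
  set yCoeff := Ω ^ 2 * lam * coefK μ α β lam ω / eTilde μ α β lam ω ^ 2 * a₄ with hy
  have h := mean_trig hΩ 0 (-(ρ ^ 2 / Ω * coefD α β / lam * (ρ ^ 2 * a) ^ 2))
    (ρ ^ 2 / Ω * (γ * a₄ - coefD α β / lam * (2 * ρ ^ 2 * a * a₄)))
    (-(ρ ^ 2 / Ω * coefD α β / lam * a₄ ^ 2)) (-(ρ ^ 2 / Ω * yCoeff * (ρ ^ 2 * a)))
    (-(ρ ^ 2 / Ω * yCoeff * a₄))
  refine Eq.trans (congrArg _ ?_) (h.trans (by rw [hy]; ring))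
  funext τ
  simp only [rescaledVF, Matrix.cons_val, hy]
  ring

/-- The mean of `ρ⁻⁴` times the consistency defect along the starting vector with `a₂₂ = a` and
`σ = ω₃ - d a₂₂`, where `ε = ρ²`, `V = Ω²` and `W = ω₁²`. Here `P = ε p` with
`p = q + a₄ cos Ωτ`, and `b₀ + b₁ p - b₂ p²` is the factor multiplying `ε² R²` in `M`. -/
def defectMean (α β lam a₄ ε a σ e V W : ℝ) : ℝ :=
  let s := 1 + α * β
  let m := 1 + α ^ 2
  let d := coefD α β
  let b₀ := d * m / 2 * W * a - s * e * σ
  let b₁ := s * ε * d * σ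
  let b₂ := d ^ 2 * m / (2 * lam) + s * d ^ 2
  let q := ε * a
  m * (e * b₀ + (e * b₁ + d * ε * b₀) * q + (d * ε * b₁ - e * b₂) * (q ^ 2 + a₄ ^ 2 / 2)
      - d * ε * b₂ * (q ^ 3 + 3 * q * a₄ ^ 2 / 2))
    - (m ^ 2 * d ^ 2 / 4 + e ^ 2 / W ^ 2) * V * a₄ ^ 2 / 2

/-- The three normalized means of `startingMap`, computed in closed form. -/
def startingMeans (μ α β lam a₄ ρ : ℝ) (p : Fin 3 → ℝ) : Fin 3 → ℝ :=
  let σ := p 2 - coefD α β * p 0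
  let e := coefE μ α β (detunedFreq μ α β (ρ ^ 4 * σ))
  let W := linFreqSq μ α β (ρ ^ 4 * σ)
  let V := W + ρ ^ 2 * p 1
  let k := lam / coefA α β * (e - lam * W)
  ![p 0 * (lam * e / coefA α β)
      - k * (coefD α β / (lam * W)) * (ρ ^ 4 * p 0 ^ 2 + a₄ ^ 2 / 2),
    p 1 - ρ ^ 2 * (2 * coefD α β / lam * p 0 + V * lam * k / (lam * W) ^ 2 * p 0),
    -(4 * (1 + α * β) * lam / ((1 + α ^ 2) * μ))
      * defectMean α β lam a₄ (ρ ^ 2) (p 0) σ e V W]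

theorem consistencyDefect_start (h : β - α ≠ 0) (hl : lam ≠ 0) (Ω τ ρ a σ : ℝ) :
    let ω := detunedFreq μ α β (ρ ^ 4 * σ)
    let e := coefE μ α β ω
    let W := linFreqSq μ α β (ρ ^ 4 * σ)
    let p := ρ ^ 2 * a + a₄ * Real.cos (Ω * τ)
    W ≠ 0 → consistencyDefect μ α β lam ω (physical μ α β lam ω ρ Ω τ ![0, ρ * a, 0, a₄])
      = ρ ^ 4 * ((1 + α ^ 2) * ((coefD α β * ρ ^ 2 * p + e)
          * (coefD α β * (1 + α ^ 2) / 2 * W * a - (1 + α * β) * e * σ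
            + (1 + α * β) * ρ ^ 2 * coefD α β * σ * p
            - (coefD α β ^ 2 * (1 + α ^ 2) / (2 * lam) + (1 + α * β) * coefD α β ^ 2) * p ^ 2))
        - ((1 + α ^ 2) ^ 2 * coefD α β ^ 2 / 4 + e ^ 2 / W ^ 2) * Ω ^ 2 * a₄ ^ 2
          * Real.sin (Ω * τ) ^ 2) := by
  intro ω e W p hW
  have hA := coefA_ne_zero h
  have het : eTilde μ α β lam ω = lam * W := eTilde_detunedFreq h μ lam _
  have hY := physical_eq μ α β lam ω ρ Ω τ ![0, ρ * a, 0, a₄]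
  set Y := physical μ α β lam ω ρ Ω τ ![0, ρ * a, 0, a₄]
  have hY0 : Y 0 = (ρ ^ 2) ^ 2 * (lam * W * a) := by
    simp only [hY, het, Matrix.cons_val]
    ring
  have hY2 : Y 2 = ρ ^ 2 * p := by
    simp only [hY, Matrix.cons_val, p]
    ring
  have hY3 : Y 3 = -(ρ ^ 2 * (Ω * a₄ * Real.sin (Ω * τ))) := by
    simp only [hY, Matrix.cons_val]
    ring
  have hG : coefA α β / lam * Y 1 - lam * Y 3 = ρ ^ 2 * (a₄ * Ω * e / W * Real.sin (Ω * τ)) := by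
    simp only [hY, Matrix.cons_val, coefK, het, show coefE μ α β ω = e from rfl]
    field_simp
    ring
  have hM := bigM_detunedFreq h hl μ (ρ ^ 2) σ (lam * W * a) p hY0 hY2
  rw [← pow_mul, show 2 * 2 = 4 from rfl] at hM
  rw [consistencyDefect, hG, show detunedFreq μ α β (ρ ^ 4 * σ) = ω from rfl] at *
  rw [hM, hY3]
  field_simp
  ring

theorem mean_consistencyDefect_start (h : β - α ≠ 0) (hl : lam ≠ 0) {Ω : ℝ} (hΩ : Ω ≠ 0)
    (ρ a σ : ℝ) (hW : linFreqSq μ α β (ρ ^ 4 * σ) ≠ 0) :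
    let ω := detunedFreq μ α β (ρ ^ 4 * σ)
    mean (2 * Real.pi / Ω) (fun τ =>
        consistencyDefect μ α β lam ω (physical μ α β lam ω ρ Ω τ ![0, ρ * a, 0, a₄]))
      = ρ ^ 4 * defectMean α β lam a₄ (ρ ^ 2) a σ (coefE μ α β ω) (Ω ^ 2)
          (linFreqSq μ α β (ρ ^ 4 * σ)) := by
  simp only [consistencyDefect_start h hl Ω _ ρ a σ hW, defectMean]
  set s := 1 + α * β
  set m := 1 + α ^ 2
  set d := coefD α β
  set e := coefE μ α β (detunedFreq μ α β (ρ ^ 4 * σ))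
  set W := linFreqSq μ α β (ρ ^ 4 * σ)
  set b₀ := d * m / 2 * W * a - s * e * σ with hb₀
  set b₁ := s * ρ ^ 2 * d * σ with hb₁
  set b₂ := d ^ 2 * m / (2 * lam) + s * d ^ 2 with hb₂
  refine Eq.trans (congrArg _ (funext fun τ => ?_)) ((mean_cubic hΩ (ρ ^ 2 * a) a₄
    (ρ ^ 4 * (m * (e * b₀))) (ρ ^ 4 * (m * (e * b₁ + d * ρ ^ 2 * b₀)))
    (ρ ^ 4 * (m * (d * ρ ^ 2 * b₁ - e * b₂))) (-(ρ ^ 4 * (m * (d * ρ ^ 2 * b₂))))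
    (-(ρ ^ 4 * ((m ^ 2 * d ^ 2 / 4 + e ^ 2 / W ^ 2) * Ω ^ 2 * a₄ ^ 2)))).trans (by ring))
  rw [hb₀, hb₁, hb₂]
  ring

theorem startingMap_eq_startingMeans (h : β - α ≠ 0) (hl : lam ≠ 0) (ha₄ : a₄ ≠ 0) {ρ : ℝ}
    (hρ : ρ ≠ 0) (p : Fin 3 → ℝ)
    (hW : linFreqSq μ α β (ρ ^ 4 * (p 2 - coefD α β * p 0)) ≠ 0)
    (hV : 0 < linFreqSq μ α β (ρ ^ 4 * (p 2 - coefD α β * p 0)) + ρ ^ 2 * p 1) :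
    startingMap μ α β lam a₄ ρ p = startingMeans μ α β lam a₄ ρ p := by
  have hA := coefA_ne_zero h
  set σ := p 2 - coefD α β * p 0 with hσ
  set ω := carrierFreq μ α β ρ (p 0) (p 2) with hω
  have hωσ : ω = detunedFreq μ α β (ρ ^ 4 * σ) := rfl
  have het : eTilde μ α β lam ω = lam * linFreqSq μ α β (ρ ^ 4 * σ) :=
    eTilde_detunedFreq h μ lam _
  set Ω := spatialFreq μ α β lam ω ρ (p 1) with hΩdef
  have hΩeq : Ω = Real.sqrt (linFreqSq μ α β (ρ ^ 4 * σ) + ρ ^ 2 * p 1) := by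
    rw [hΩdef, spatialFreq, het, mul_div_cancel_left₀ _ hl]
  have hΩ : Ω ≠ 0 := hΩeq ▸ (Real.sqrt_pos.mpr hV).ne'
  have hΩsq : Ω ^ 2 = linFreqSq μ α β (ρ ^ 4 * σ) + ρ ^ 2 * p 1 := by
    rw [hΩeq, Real.sq_sqrt hV.le]
  simp only [startingMap, startingMeans, ← hω, ← hΩdef, ← hσ]
  rw [mean_rescaledVF_zero hΩ, mean_rescaledVF_two hΩ, hωσ,
    mean_consistencyDefect_start h hl hΩ ρ (p 0) σ hW, ← hωσ, hΩsq, coefK, het]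
  congr 1
  · field_simp
  · congr 1
    · field_simp
    · congr 1
      field_simp

theorem startingMeans_zero (hs : 1 + α * β < 0) (hμ : μ ≠ 0) (hl : lam ≠ 0) (p : Fin 3 → ℝ) :
    startingMeans μ α β lam a₄ 0 p = determiningMap μ α β lam a₄ p := by
  have h := beta_sub_alpha_ne_zero hs
  have hs' := hs.ne
  have hA := coefA_ne_zero h
  have hm := (one_add_sq_pos α).ne'
  funext i
  fin_cases i
  · simp [startingMeans, determiningMap, coefK, eTilde_base h, coefE_base h]
    field_simp
  · simp [startingMeans, determiningMap]
  · simp [startingMeans, determiningMap, defectMean, coefE_base h, linFreqSq_zero h]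
    field_simp
    ring

theorem continuousAt_startingMeans (hs : 1 + α * β < 0) (hμ : 0 < μ) (hl : lam ≠ 0)
    (p : Fin 3 → ℝ) :
    ContinuousAt (fun ρ => startingMeans μ α β lam a₄ ρ p) 0 := by
  have h := beta_sub_alpha_ne_zero hs
  have hA := coefA_ne_zero h
  have hF := continuous_linFreqSq h μ
  have hW : linFreqSq μ α β (0 ^ 4 * (p 2 - coefD α β * p 0)) ≠ 0 := by
    simpa using (linFreqSq_zero_pos hμ hs).ne'
  refine continuousAt_pi.mpr fun i => ?_
  fin_cases i <;>
    simp only [startingMeans, defectMean, coefE_detunedFreq h, Fin.zero_eta, Fin.mk_one,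
      Fin.reduceFinMk, Matrix.cons_val] <;>
    fun_prop (disch := simp_all)

theorem tendsto_startingMap (hμ : 0 < μ) (hs : 1 + α * β < 0) (hl : lam ≠ 0) (ha₄ : a₄ ≠ 0)
    (p : Fin 3 → ℝ) :
    Filter.Tendsto (fun ρ => startingMap μ α β lam a₄ ρ p)
      (nhdsWithin 0 {0}ᶜ) (nhds (determiningMap μ α β lam a₄ p)) := by
  have h := beta_sub_alpha_ne_zero hs
  have hF := continuous_linFreqSq h μ
  have hpos (c : ℝ) : ∀ᶠ ρ in nhds (0 : ℝ),
      0 < linFreqSq μ α β (ρ ^ 4 * (p 2 - coefD α β * p 0)) + ρ ^ 2 * c := by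
    have hc : Continuous fun ρ : ℝ =>
        linFreqSq μ α β (ρ ^ 4 * (p 2 - coefD α β * p 0)) + ρ ^ 2 * c := by fun_prop
    exact hc.continuousAt.eventually_const_lt (by simpa using linFreqSq_zero_pos hμ hs)
  refine Filter.Tendsto.congr' ?_ (startingMeans_zero hs hμ.ne' hl p ▸
    (continuousAt_startingMeans hs hμ hl p).tendsto.mono_left nhdsWithin_le_nhds)
  filter_upwards [self_mem_nhdsWithin, mem_nhdsWithin_of_mem_nhds (hpos 0),
    mem_nhdsWithin_of_mem_nhds (hpos (p 1))] with ρ hρ hW hV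
  exact (startingMap_eq_startingMeans h hl ha₄ hρ p (by simpa using hW.ne') hV).symm

end Starting

/-! ### From the four-dimensional system to the Ginzburg–Landau equation -/

theorem contDiff_of_isIntegralCurve {E : Type*} [NormedAddCommGroup E] [NormedSpace ℝ E]
    {F : E → E} (hF : ContDiff ℝ ((⊤ : ℕ∞) : WithTop ℕ∞) F) {Y : ℝ → E}
    (hY : IsIntegralCurve Y fun _ => F) : ContDiff ℝ ((⊤ : ℕ∞) : WithTop ℕ∞) Y := by
  refine contDiff_infty.mpr fun n => ?_
  induction n with
  | zero => exact contDiff_zero.mpr (continuous_iff_continuousAt.mpr fun t => (hY t).continuousAt)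
  | succ n ih =>
    push_cast
    rw [contDiff_succ_iff_deriv, show deriv Y = F ∘ Y from funext fun t => (hY t).deriv]
    exact ⟨fun t => (hY t).differentiableAt, by simp, (contDiff_infty.mp hF n).comp ih⟩

theorem iteratedDeriv_two_eq {E : Type*} [NormedAddCommGroup E] [NormedSpace ℝ E]
    {f f' : ℝ → E} {f'' : E} {x : ℝ} (hf : ∀ y, HasDerivAt f (f' y) y)
    (hf' : HasDerivAt f' f'' x) : iteratedDeriv 2 f x = f'' := by
  rw [iteratedDeriv_succ, iteratedDeriv_one, funext fun y => (hf y).deriv, hf'.deriv]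

theorem hasDerivAt_deriv {E : Type*} [NormedAddCommGroup E] [NormedSpace ℝ E] {f : ℝ → E}
    (hf : ContDiff ℝ 2 f) (x : ℝ) : HasDerivAt (deriv f) (iteratedDeriv 2 f x) x := by
  rw [iteratedDeriv_succ, iteratedDeriv_one]
  have h := hf.differentiable_iteratedDeriv 1 (by norm_num)
  rw [iteratedDeriv_one] at h
  exact (h x).hasDerivAt

section Polar

variable {μ α β ω : ℝ} {R φ : ℝ → ℝ}

theorem contDiff_field (hR : ContDiff ℝ 2 R) (hφ : ContDiff ℝ 2 φ) :
    ContDiff ℝ 2 (fun p : ℝ × ℝ => field ω R φ p.1 p.2) := by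
  have hc : ContDiff ℝ 2 (fun x : ℝ => (x : ℂ)) := Complex.ofRealCLM.contDiff
  have h1 : ContDiff ℝ 2 (fun p : ℝ × ℝ => (R p.1 : ℂ)) := hc.comp (hR.comp contDiff_fst)
  have h2 : ContDiff ℝ 2 (fun p : ℝ × ℝ => (φ p.1 : ℂ)) := hc.comp (hφ.comp contDiff_fst)
  have h3 : ContDiff ℝ 2 (fun p : ℝ × ℝ => (p.2 : ℂ)) := hc.comp contDiff_snd
  exact h1.mul ((contDiff_const.mul h2).sub (contDiff_const.mul h3)).cexp

theorem norm_field (ω : ℝ) (R φ : ℝ → ℝ) (x t : ℝ) : ‖field ω R φ x t‖ = |R x| := by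
  have h : Complex.I * (φ x : ℂ) - Complex.I * (ω : ℂ) * (t : ℂ)
      = ((φ x - ω * t : ℝ) : ℂ) * Complex.I := by
    push_cast
    ring
  rw [field, h, norm_mul, Complex.norm_exp_ofReal_mul_I, mul_one, Complex.norm_real,
    Real.norm_eq_abs]

theorem deriv_field_time (ω : ℝ) (R φ : ℝ → ℝ) (x t : ℝ) :
    deriv (fun s => field ω R φ x s) t = -(Complex.I * ω) * field ω R φ x t := by
  have h := ((((Complex.ofRealCLM.hasDerivAt (x := t)).const_mul
    (Complex.I * (ω : ℂ))).const_sub (Complex.I * (φ x : ℂ))).cexp).const_mul (R x : ℂ)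
  refine h.deriv.trans ?_
  simp only [Complex.ofRealCLM_apply, Complex.ofReal_one, field]
  ring

theorem iteratedDeriv_two_field (hR : ContDiff ℝ 2 R) (hφ : ContDiff ℝ 2 φ) (x t : ℝ) :
    iteratedDeriv 2 (fun y => field ω R φ y t) x
      = (((iteratedDeriv 2 R x - R x * deriv φ x ^ 2 : ℝ) : ℂ)
          + Complex.I * ((2 * deriv R x * deriv φ x + R x * iteratedDeriv 2 φ x : ℝ) : ℂ))
        * Complex.exp (Complex.I * (φ x : ℂ) - Complex.I * (ω : ℂ) * (t : ℂ)) := by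
  have hR' (y : ℝ) : HasDerivAt (fun y => (R y : ℂ)) (deriv R y : ℝ) y :=
    (hR.differentiable (by norm_num) y).hasDerivAt.ofReal_comp
  have hφ' (y : ℝ) : HasDerivAt (fun y => (φ y : ℂ)) (deriv φ y : ℝ) y :=
    (hφ.differentiable (by norm_num) y).hasDerivAt.ofReal_comp
  have hexp (y : ℝ) := (((hφ' y).const_mul Complex.I).sub_const (Complex.I * ω * t)).cexp
  have hR'' := (hasDerivAt_deriv hR x).ofReal_comp
  have hφ'' := (hasDerivAt_deriv hφ x).ofReal_comp
  refine iteratedDeriv_two_eq (fun y => (hR' y).mul (hexp y)) (HasDerivAt.congr_deriv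
    ((hR''.mul (hexp x)).add ((hR' x).mul ((hexp x).mul (hφ''.const_mul Complex.I)))) ?_)
  push_cast
  linear_combination (R x * deriv φ x ^ 2
    * Complex.exp (Complex.I * (φ x : ℂ) - Complex.I * (ω : ℂ) * (t : ℂ))) * Complex.I_sq

namespace SolvesAmplitudePhase

theorem radial_eq (hS : SolvesAmplitudePhase μ α β ω R φ) {x : ℝ} (hx : R x ≠ 0) :
    (1 + α ^ 2) * (iteratedDeriv 2 R x - R x * deriv φ x ^ 2)
      = (1 + α * β) * R x ^ 3 - (α * ω + μ) * R x := by
  have h := (hS.2.2 x).2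
  rw [angMom] at h
  refine mul_left_cancel₀ (pow_ne_zero 3 hx) ?_
  linear_combination -h

theorem azimuthal_eq (hS : SolvesAmplitudePhase μ α β ω R φ) {x : ℝ} (hx : R x ≠ 0) :
    (1 + α ^ 2) * (2 * deriv R x * deriv φ x + R x * iteratedDeriv 2 φ x)
      = (β - α) * R x ^ 3 - (ω - μ * α) * R x := by
  have hR := (hS.1.differentiable (by simp) x).hasDerivAt
  have hG := ((hasDerivAt_deriv (contDiff_infty.mp hS.2.1 2) x).mul (hR.pow 2)).deriv
  have h := (hS.2.2 x).1
  rw [show deriv (angMom R φ) x = _ from hG, Nat.cast_ofNat, pow_one, Pi.pow_apply] at h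
  refine mul_left_cancel₀ hx ?_
  linear_combination h

theorem solvesCGL_field (hS : SolvesAmplitudePhase μ α β ω R φ) (hpos : ∀ x, 0 < R x) :
    SolvesCGL μ α β (field ω R φ) := by
  have hR := contDiff_infty.mp hS.1 2
  have hφ := contDiff_infty.mp hS.2.1 2
  refine ⟨contDiff_field hR hφ, fun x t => ?_⟩
  have hm := (one_add_sq_pos α).ne'
  have hmc : (1 + (α : ℂ) ^ 2) ≠ 0 := by exact_mod_cast hm
  rw [deriv_field_time, iteratedDeriv_two_field hR hφ, norm_field, sq_abs,
    eq_div_of_mul_eq hm ((mul_comm _ _).trans (hS.radial_eq (hpos x).ne')),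
    eq_div_of_mul_eq hm ((mul_comm _ _).trans (hS.azimuthal_eq (hpos x).ne')), field]
  push_cast
  field_simp
  ring_nf
  simp only [Complex.I_sq]
  ring

end SolvesAmplitudePhase

end Polar

theorem contDiff_vf4 (μ α β lam ω : ℝ) :
    ContDiff ℝ ((⊤ : ℕ∞) : WithTop ℕ∞) (vf4 μ α β lam ω) := by
  refine contDiff_pi.mpr fun i => ?_
  fin_cases i <;>
    simp only [vf4, Fin.zero_eta, Fin.mk_one, Fin.reduceFinMk, Matrix.cons_val] <;>
    fun_prop

/-- The squared amplitude `R² = dP + e`. -/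
def ampSq (μ α β ω : ℝ) (Y : Fin 4 → ℝ) : ℝ := coefD α β * Y 2 + coefE μ α β ω

/-- The angular momentum `G = φ_x R²` in the variables `(M̃, Ñ, P, Q)`. -/
def momentum (α β lam : ℝ) (Y : Fin 4 → ℝ) : ℝ :=
  (coefA α β / lam * Y 1 - lam * Y 3) / (1 + α ^ 2)

section System

variable {μ α β lam ω : ℝ} {Y : ℝ → Fin 4 → ℝ}

theorem contDiff_component (hY : IsIntegralCurve Y fun _ => vf4 μ α β lam ω) (i : Fin 4) :
    ContDiff ℝ ((⊤ : ℕ∞) : WithTop ℕ∞) (fun τ => Y τ i) :=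
  contDiff_pi.mp (contDiff_of_isIntegralCurve (contDiff_vf4 μ α β lam ω) hY) i

theorem hasDerivAt_ampSq (hY : IsIntegralCurve Y fun _ => vf4 μ α β lam ω) (τ : ℝ) :
    HasDerivAt (fun τ => ampSq μ α β ω (Y τ)) (coefD α β * Y τ 3) τ :=
  ((hasDerivAt_pi.mp (hY τ) 2).const_mul _).add_const _

theorem hasDerivAt_momentum (h : β - α ≠ 0) (hl : lam ≠ 0)
    (hY : IsIntegralCurve Y fun _ => vf4 μ α β lam ω) (τ : ℝ) :
    HasDerivAt (fun τ => momentum α β lam (Y τ))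
      (ampSq μ α β ω (Y τ) * Y τ 2 / (1 + α ^ 2)) τ := by
  have ha := coefA_ne_zero h
  refine ((((hasDerivAt_pi.mp (hY τ) 1).const_mul (coefA α β / lam)).sub
    ((hasDerivAt_pi.mp (hY τ) 3).const_mul lam)).div_const _).congr_deriv ?_
  simp only [vf4, Matrix.cons_val, coefK, ampSq]
  field_simp
  ring

theorem consistencyDefect_eq_momentum (μ α β lam ω : ℝ) (y : Fin 4 → ℝ) :
    consistencyDefect μ α β lam ω y
      = (1 + α ^ 2) * bigM μ α β lam ω y - (1 + α ^ 2) ^ 2 * momentum α β lam y ^ 2 := by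
  rw [consistencyDefect, momentum, ← mul_pow, mul_div_cancel₀ _ (one_add_sq_pos α).ne']

theorem hasDerivAt_consistencyDefect (h : β - α ≠ 0)
    (hlam : lam ^ 2 + coefC α β * lam - 2 * coefA α β * coefD α β = 0)
    (hY : IsIntegralCurve Y fun _ => vf4 μ α β lam ω) (τ : ℝ) :
    HasDerivAt (fun τ => consistencyDefect μ α β lam ω (Y τ)) 0 τ := by
  have hl := root_ne_zero h hlam
  have hm := (one_add_sq_pos α).ne'
  have h0 : HasDerivAt (fun τ => Y τ 0) _ τ := hasDerivAt_pi.mp (hY τ) 0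
  have h2 : HasDerivAt (fun τ => Y τ 2) _ τ := hasDerivAt_pi.mp (hY τ) 2
  have h3 : HasDerivAt (fun τ => Y τ 3) _ τ := hasDerivAt_pi.mp (hY τ) 3
  have hu := hasDerivAt_ampSq hY τ
  have hw := (h0.sub ((h2.pow 2).const_mul (coefD α β))).sub (h2.const_mul (eTilde μ α β lam ω))
  have hM : HasDerivAt (fun τ => bigM μ α β lam ω (Y τ)) _ τ :=
    ((((hu.const_mul (coefD α β * (1 + α ^ 2) / (2 * lam))).mul hw).sub
      ((h3.pow 2).const_mul (coefD α β ^ 2 * (1 + α ^ 2) / 4))).add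
      ((hu.pow 2).const_mul (α * ω + μ))).sub ((hu.pow 3).const_mul (1 + α * β))
  simp only [consistencyDefect_eq_momentum]
  refine ((hM.const_mul (1 + α ^ 2)).sub (((hasDerivAt_momentum h hl hY τ).pow 2).const_mul
    ((1 + α ^ 2) ^ 2))).congr_deriv ?_
  simp only [Pi.sub_apply, Pi.pow_apply, momentum, ampSq, vf4, Matrix.cons_val,
    eTilde_eq h μ lam ω, coefA_eq]
  push_cast
  field_simp
  linear_combination (16 * Y τ 2 * Y τ 3 * (coefD α β * Y τ 2 + coefE μ α β ω)) * root_sq hlam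

theorem consistencyDefect_const (h : β - α ≠ 0)
    (hlam : lam ^ 2 + coefC α β * lam - 2 * coefA α β * coefD α β = 0)
    (hY : IsIntegralCurve Y fun _ => vf4 μ α β lam ω) (τ τ' : ℝ) :
    consistencyDefect μ α β lam ω (Y τ) = consistencyDefect μ α β lam ω (Y τ') :=
  is_const_of_deriv_eq_zero
    (fun τ => (hasDerivAt_consistencyDefect h hlam hY τ).differentiableAt)
    (fun τ => (hasDerivAt_consistencyDefect h hlam hY τ).deriv) τ τ'

theorem contDiff_ampSq (hY : IsIntegralCurve Y fun _ => vf4 μ α β lam ω) :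
    ContDiff ℝ ((⊤ : ℕ∞) : WithTop ℕ∞) (fun τ => ampSq μ α β ω (Y τ)) :=
  (contDiff_const.mul (contDiff_component hY 2)).add contDiff_const

theorem contDiff_momentum (hY : IsIntegralCurve Y fun _ => vf4 μ α β lam ω) :
    ContDiff ℝ ((⊤ : ℕ∞) : WithTop ℕ∞) (fun τ => momentum α β lam (Y τ)) :=
  ((contDiff_const.mul (contDiff_component hY 1)).sub
    (contDiff_const.mul (contDiff_component hY 3))).div_const _

theorem contDiff_amplitude (hY : IsIntegralCurve Y fun _ => vf4 μ α β lam ω)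
    (hpos : ∀ x, 0 < ampSq μ α β ω (Y x)) :
    ContDiff ℝ ((⊤ : ℕ∞) : WithTop ℕ∞) (amplitude μ α β ω Y) :=
  (contDiff_ampSq hY).sqrt fun x => (hpos x).ne'

theorem contDiff_phaseGrad (hY : IsIntegralCurve Y fun _ => vf4 μ α β lam ω)
    (hpos : ∀ x, 0 < ampSq μ α β ω (Y x)) :
    ContDiff ℝ ((⊤ : ℕ∞) : WithTop ℕ∞)
      (fun x => momentum α β lam (Y x) / ampSq μ α β ω (Y x)) :=
  (contDiff_momentum hY).div (contDiff_ampSq hY) fun x => (hpos x).ne'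

theorem hasDerivAt_phase (hY : IsIntegralCurve Y fun _ => vf4 μ α β lam ω)
    (hpos : ∀ x, 0 < ampSq μ α β ω (Y x)) (x : ℝ) :
    HasDerivAt (phase μ α β lam ω Y) (momentum α β lam (Y x) / ampSq μ α β ω (Y x)) x :=
  ((contDiff_phaseGrad hY hpos).continuous.integral_hasStrictDerivAt 0 x).hasDerivAt

theorem contDiff_phase (hY : IsIntegralCurve Y fun _ => vf4 μ α β lam ω)
    (hpos : ∀ x, 0 < ampSq μ α β ω (Y x)) :
    ContDiff ℝ ((⊤ : ℕ∞) : WithTop ℕ∞) (phase μ α β lam ω Y) := by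
  rw [contDiff_infty_iff_deriv, funext fun x => (hasDerivAt_phase hY hpos x).deriv]
  exact ⟨fun x => (hasDerivAt_phase hY hpos x).differentiableAt, contDiff_phaseGrad hY hpos⟩

theorem angMom_eq_momentum (hY : IsIntegralCurve Y fun _ => vf4 μ α β lam ω)
    (hpos : ∀ x, 0 < ampSq μ α β ω (Y x)) :
    angMom (amplitude μ α β ω Y) (phase μ α β lam ω Y) = fun x => momentum α β lam (Y x) := by
  funext x
  rw [angMom, (hasDerivAt_phase hY hpos x).deriv,
    show amplitude μ α β ω Y x ^ 2 = ampSq μ α β ω (Y x) from Real.sq_sqrt (hpos x).le,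
    div_mul_cancel₀ _ (hpos x).ne']

theorem bigM_eq_amplitude (hY : IsIntegralCurve Y fun _ => vf4 μ α β lam ω)
    (hpos : ∀ x, 0 < ampSq μ α β ω (Y x)) (x : ℝ) :
    bigM μ α β lam ω (Y x) = (1 + α ^ 2) * amplitude μ α β ω Y x ^ 3
      * iteratedDeriv 2 (amplitude μ α β ω Y) x + (α * ω + μ) * amplitude μ α β ω Y x ^ 4
      - (1 + α * β) * amplitude μ α β ω Y x ^ 6 := by
  have hsq : amplitude μ α β ω Y x ^ 2 = coefD α β * Y x 2 + coefE μ α β ω :=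
    Real.sq_sqrt (hpos x).le
  have hne : amplitude μ α β ω Y x ≠ 0 := (Real.sqrt_pos.mpr (hpos x)).ne'
  have hR (x : ℝ) : HasDerivAt (amplitude μ α β ω Y)
      (coefD α β * Y x 3 / (2 * amplitude μ α β ω Y x)) x :=
    (hasDerivAt_ampSq hY x).sqrt (hpos x).ne'
  rw [iteratedDeriv_two_eq hR (((hasDerivAt_pi.mp (hY x) 3).const_mul (coefD α β)).div
    ((hR x).const_mul 2) (mul_ne_zero two_ne_zero hne)), bigM, ← hsq]
  simp only [vf4, Matrix.cons_val]
  field_simp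
  ring

theorem solvesAmplitudePhase (h : β - α ≠ 0) (hl : lam ≠ 0)
    (hY : IsIntegralCurve Y fun _ => vf4 μ α β lam ω)
    (hpos : ∀ x, 0 < ampSq μ α β ω (Y x))
    (hdef : ∀ τ, consistencyDefect μ α β lam ω (Y τ) = 0) :
    SolvesAmplitudePhase μ α β ω (amplitude μ α β ω Y) (phase μ α β lam ω Y) := by
  have hm := (one_add_sq_pos α).ne'
  refine ⟨contDiff_amplitude hY hpos, contDiff_phase hY hpos, fun x => ⟨?_, ?_⟩⟩
  · have hsq : amplitude μ α β ω Y x ^ 2 = ampSq μ α β ω (Y x) := Real.sq_sqrt (hpos x).le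
    rw [angMom_eq_momentum hY hpos, (hasDerivAt_momentum h hl hY x).deriv,
      show amplitude μ α β ω Y x ^ 4 = (amplitude μ α β ω Y x ^ 2) ^ 2 by ring, hsq,
      mul_div_cancel₀ _ hm, ampSq, coefD, coefE]
    field_simp
    ring
  · have hx := hdef x
    rw [consistencyDefect_eq_momentum] at hx
    rw [angMom_eq_momentum hY hpos, ← bigM_eq_amplitude hY hpos]
    refine mul_left_cancel₀ hm ?_
    linear_combination -hx

end System

/-! ### Stretched periodic functions -/

section Stretch

variable {ι : Type*} {Ω : ℝ} {F F' : ι → PerFun}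

/-- The functions of `τ` obtained from functions of the angle `θ = Ω τ`. -/
def stretch (Ω : ℝ) (F : ι → PerFun) (τ : ℝ) (i : ι) : ℝ := F i (Ω * τ : ℝ)

theorem hasDerivAt_stretch [Finite ι] (h : ∀ i, HasDeriv (F i) (F' i)) (τ : ℝ) :
    HasDerivAt (stretch Ω F) (Ω • stretch Ω F' τ) τ :=
  have := Fintype.ofFinite ι
  hasDerivAt_pi.mpr fun i =>
    ((h i (Ω * τ)).comp τ ((hasDerivAt_id τ).const_mul Ω)).congr_deriv
      (by simp [stretch, mul_comm])

theorem periodic_stretch (hΩ : Ω ≠ 0) (F : ι → PerFun) :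
    Function.Periodic (stretch Ω F) (2 * Real.pi / Ω) := fun τ => funext fun i => by
  rw [stretch, mul_add, mul_div_cancel₀ _ hΩ]
  exact (F i).periodic_line (Ω * τ)

theorem stretch_neg_of_even {i : ι} (h : Function.Even (F i)) (τ : ℝ) :
    stretch Ω F (-τ) i = stretch Ω F τ i := by
  rw [stretch, mul_neg, Real.Angle.coe_neg, h, stretch]

theorem stretch_neg_of_odd {i : ι} (h : Function.Odd (F i)) (τ : ℝ) :
    stretch Ω F (-τ) i = -stretch Ω F τ i := by
  rw [stretch, mul_neg, Real.Angle.coe_neg, h, stretch]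

theorem continuousAt_stretch {X : Type*} [TopologicalSpace X] {Ω : X → ℝ} {F : X → ι → PerFun}
    {x : X} (hΩ : ContinuousAt Ω x) (hF : ContinuousAt F x) (τ : ℝ) :
    ContinuousAt (fun q : X × ℝ => stretch (Ω q.1) (F q.1) q.2) (x, τ) :=
  continuousAt_pi.mpr fun i =>
    have hF' : ContinuousAt (fun q : X × ℝ => F q.1 i) (x, τ) :=
      Filter.Tendsto.comp (continuousAt_pi.mp hF i) continuousAt_fst
    have hΩ' : ContinuousAt (fun q : X × ℝ => Ω q.1) (x, τ) :=
      Filter.Tendsto.comp hΩ continuousAt_fst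
    (continuous_eval (F := PerFun)).continuousAt.comp₂ hF'
      (Real.Angle.continuous_coe.continuousAt.comp (hΩ'.mul continuousAt_snd))

theorem tendsto_stretch {X : Type*} {l : Filter X} {Ω : X → ℝ} {F : X → ι → PerFun} {b : ι → ℝ}
    (h : Filter.Tendsto F l (nhds fun i => b i • 1)) :
    Filter.Tendsto (fun q : X × ℝ => stretch (Ω q.1) (F q.1) q.2) (l ×ˢ ⊤) (nhds b) := by
  refine tendsto_pi_nhds.mpr fun i => tendsto_iff_norm_sub_tendsto_zero.mpr ?_
  refine squeeze_zero (fun _ => norm_nonneg _) (fun q => ?_)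
    ((tendsto_iff_norm_sub_tendsto_zero.mp (tendsto_pi_nhds.mp h i)).comp Filter.tendsto_fst)
  simpa [stretch] using (F q.1 i - b i • 1).norm_coe_le_norm (Ω q.1 * q.2 : ℝ)

end Stretch

/-! ### The profiles of the wave -/

namespace Reduced

variable (c : Reduced) (z : Unknowns) (ρ : ℝ)

/-- The spatial frequency `Ω`. -/
def Ω : ℝ := Real.sqrt (c.ΩSq z)

/-- The profile of `z̃ = z₁ sin θ + z₂ cos θ`, that is, of `P / ε - ỹ`. -/
def zTilde : PerFun := c.p z - (z.ε / (c.lam * c.ω₁Sq z)) • z.h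

/-- The profile of `X = (x₁, x₂, z₁, z₂)`. -/
def profile : Fin 4 → PerFun :=
  ![(c.Ω z)⁻¹ • c.n z + (c.k z * c.Ω z / c.ω₁Sq z) • c.q z,
    (ρ / (c.lam * c.ω₁Sq z)) • z.h,
    c.zTilde z * sin + c.q z * cos,
    c.zTilde z * cos - c.q z * sin]

/-- The profile of `Y = (M̃, Ñ, P, Q)`. -/
def orbit : Fin 4 → PerFun :=
  ![z.ε ^ 2 • z.h, (z.ε * (c.Ω z)⁻¹) • c.n z, z.ε • c.p z, (z.ε * c.Ω z) • c.q z]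

/-- The profile of the squared amplitude `dP + e`. -/
def ampSqProfile : PerFun := (c.d * z.ε) • c.p z + c.e z • 1

/-- The mean of `x₂` divided by `ρ`. -/
def a₂₂ : ℝ := c.hMean z / (c.lam * c.ω₁Sq z)

/-- The carrier frequency parameter `ω₃`. -/
def ω₃ : ℝ := z.σ + c.d * c.a₂₂ z

/-- The right-hand side of the equation for `X` divided by `Ω`, in terms of the profiles. -/
def profileDeriv : Fin 4 → PerFun :=
  let g₁ := -(z.ε / (c.lam * c.ω₁Sq z * c.ΩSq z)) • (c.n z * c.p z)
  let g₂ := (z.ε * (c.ΩSq z)⁻¹) • (z.γ • c.zTilde z - (c.d / c.lam) • (c.p z * c.p z))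
  ![(z.ε * (c.Ω z)⁻¹) • ((c.e z / (c.a * c.ω₁Sq z)) • z.h
      - (c.k z * c.d / (c.lam * c.ω₁Sq z)) • (c.p z * c.p z)),
    (ρ / (c.lam * c.ω₁Sq z * c.ΩSq z)) • (c.n z * c.p z),
    g₁ * sin + g₂ * cos,
    g₁ * cos - g₂ * sin]

/-- The right-hand side of the equation for `Y` divided by `Ω`, in terms of the profiles. -/
def orbitDeriv : Fin 4 → PerFun :=
  ![(z.ε ^ 2 * (c.ΩSq z)⁻¹) • (c.n z * c.p z),
    (z.ε * (c.Ω z)⁻¹) • ((z.ε * (c.lam / c.a)) • z.h + c.k z • c.p z),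
    z.ε • c.q z,
    (z.ε * c.Ω z) • (z.ε • c.forcing z - c.p z)]

theorem odd_profile_zero : Function.Odd (c.profile z ρ 0) :=
  ((c.odd_n z).const_smul _).add ((c.odd_q z).const_smul _)

theorem odd_orbit_one : Function.Odd (c.orbit z 1) := (c.odd_n z).const_smul _

theorem odd_orbit_three : Function.Odd (c.orbit z 3) := (c.odd_q z).const_smul _

variable {c z}

theorem zTilde_mul_sin_add : c.profile z ρ 2 * sin + c.profile z ρ 3 * cos = c.zTilde z := by
  have h := congrArg (c.zTilde z * ·) cos_mul_cos_add_sin_mul_sin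
  simp only [mul_one] at h
  simp only [profile, Matrix.cons_val]
  linear_combination h

theorem q_eq_mul_cos_sub : c.profile z ρ 2 * cos - c.profile z ρ 3 * sin = c.q z := by
  have h := congrArg (c.q z * ·) cos_mul_cos_add_sin_mul_sin
  simp only [mul_one] at h
  simp only [profile, Matrix.cons_val]
  linear_combination h

namespace IsFixed

variable (hz : c.IsFixed z)

include hz

theorem even_zTilde : Function.Even (c.zTilde z) :=
  even_sub hz.even_p (hz.even_h.const_smul _)

theorem even_profile_one : Function.Even (c.profile z ρ 1) := hz.even_h.const_smul _

theorem odd_profile_two : Function.Odd (c.profile z ρ 2) :=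
  (hz.even_zTilde.mul_odd odd_sin).add ((c.odd_q z).mul_even even_cos)

theorem even_profile_three : Function.Even (c.profile z ρ 3) :=
  even_sub (hz.even_zTilde.mul_even even_cos) ((c.odd_q z).mul_odd odd_sin)

theorem avg_profile (i : Fin 4) :
    avg (c.profile z ρ i) = ![0, ρ * c.a₂₂ z, 0, c.amp] i := by
  fin_cases i
  · exact avg_eq_zero_of_odd (c.odd_profile_zero z ρ)
  · change avg ((ρ / (c.lam * c.ω₁Sq z)) • z.h) = ρ * c.a₂₂ z
    rw [map_smul, hz.h_eq, avg_nextH, a₂₂, smul_eq_mul]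
    ring
  · exact avg_eq_zero_of_odd (hz.odd_profile_two ρ)
  · have h : avg (cos * c.zTilde z) - avg (sin * c.q z) = c.amp := by
      rw [hz.avg_sin_mul_q, zTilde, mul_sub, map_sub, mul_smul_comm, map_smul, smul_eq_mul]
      linear_combination hz.avg_cos_mul_sub_eq_amp
    change avg (c.zTilde z * cos - c.q z * sin) = c.amp
    rwa [map_sub, mul_comm, mul_comm (c.q z)]

theorem hasDeriv_profile_zero (hΩ : 0 < c.ΩSq z) :
    HasDeriv (c.profile z ρ 0) (c.profileDeriv z ρ 0) := by
  have hlam := hz.lam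
  have ha := hz.a
  have hω := hz.ω₁Sq
  have hΩ' : c.Ω z ≠ 0 := (Real.sqrt_pos.mpr hΩ).ne'
  have hsq : c.ΩSq z = c.Ω z ^ 2 := (Real.sq_sqrt hΩ.le).symm
  have hεγ : z.ε * z.γ = c.Ω z ^ 2 - c.ω₁Sq z := by rw [← hsq, Reduced.ΩSq]; ring
  refine ((hz.hasDeriv_n.const_smul (c.Ω z)⁻¹).add
    (hz.hasDeriv_q.const_smul (c.k z * c.Ω z / c.ω₁Sq z))).congr_deriv
      (ContinuousMap.ext fun x => ?_)
  simp only [hz.forcing_eq, hz.quad_eq, profileDeriv, Matrix.cons_val, ContinuousMap.add_apply,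
    ContinuousMap.sub_apply, ContinuousMap.smul_apply, ContinuousMap.mul_apply, smul_eq_mul, hsq,
    k]
  field_simp
  linear_combination (c.e z - c.lam * c.ω₁Sq z) * c.lam * c.p z x * hεγ

theorem hasDeriv_zTilde : HasDeriv (c.zTilde z)
    (c.q z + (-(z.ε / (c.lam * c.ω₁Sq z * c.ΩSq z))) • (c.n z * c.p z)) := by
  refine (hz.hasDeriv_p.sub (hz.hasDeriv_h.const_smul _)).congr_deriv ?_
  rw [smul_smul, sub_eq_add_neg, ← neg_smul, ← div_eq_mul_inv, div_div]

theorem hasDeriv_q_zTilde : HasDeriv (c.q z)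
    ((z.ε * (c.ΩSq z)⁻¹) • (z.γ • c.zTilde z - (c.d / c.lam) • (c.p z * c.p z))
      - c.zTilde z) := by
  have hlam := hz.lam
  have hω := hz.ω₁Sq
  have hΩ' := hz.ΩSq
  have hεγ : z.ε * z.γ = c.ΩSq z - c.ω₁Sq z := by rw [Reduced.ΩSq]; ring
  refine hz.hasDeriv_q.congr_deriv (ContinuousMap.ext fun x => ?_)
  simp only [hz.forcing_eq, hz.quad_eq, zTilde, ContinuousMap.add_apply,
    ContinuousMap.sub_apply, ContinuousMap.smul_apply, ContinuousMap.mul_apply, smul_eq_mul]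
  field_simp
  linear_combination z.ε * z.h x * hεγ

theorem hasDeriv_profile (hΩ : 0 < c.ΩSq z) :
    ∀ i, HasDeriv (c.profile z ρ i) (c.profileDeriv z ρ i) := by
  have hA := hz.hasDeriv_zTilde
  have hq := hz.hasDeriv_q_zTilde
  refine Fin.forall_fin_succ.mpr ⟨hz.hasDeriv_profile_zero ρ hΩ, Fin.forall_fin_succ.mpr
    ⟨?_, Fin.forall_fin_succ.mpr ⟨?_, Fin.forall_fin_one.mpr ?_⟩⟩⟩
  · refine (hz.hasDeriv_h.const_smul (ρ / (c.lam * c.ω₁Sq z))).congr_deriv ?_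
    change _ = (ρ / (c.lam * c.ω₁Sq z * c.ΩSq z)) • (c.n z * c.p z)
    rw [smul_smul, ← div_eq_mul_inv, div_div]
  · refine ((hA.mul hasDeriv_sin).add (hq.mul hasDeriv_cos)).congr_deriv ?_
    simp only [profileDeriv, Matrix.cons_val_succ, Matrix.cons_val_zero]
    ring
  · refine ((hA.mul hasDeriv_cos).sub (hq.mul hasDeriv_sin)).congr_deriv ?_
    simp only [profileDeriv, Matrix.cons_val_succ, Matrix.cons_val_zero]
    ring

theorem even_orbit_zero : Function.Even (c.orbit z 0) := hz.even_h.const_smul _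

theorem even_orbit_two : Function.Even (c.orbit z 2) := hz.even_p.const_smul _

theorem hasDeriv_orbit : ∀ i, HasDeriv (c.orbit z i) (c.orbitDeriv z i) := by
  refine Fin.forall_fin_succ.mpr ⟨?_, Fin.forall_fin_succ.mpr
    ⟨hz.hasDeriv_n.const_smul _, Fin.forall_fin_succ.mpr
    ⟨hz.hasDeriv_p.const_smul _, Fin.forall_fin_one.mpr (hz.hasDeriv_q.const_smul _)⟩⟩⟩
  exact (hz.hasDeriv_h.const_smul _).congr_deriv (smul_smul _ _ _)

end IsFixed

end Reduced

/-! ### Symmetric periodic solutions -/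

section Symmetric

variable {μ α β lam ω T : ℝ} {Y : ℝ → Fin 4 → ℝ}

/-- Reversibility of `τ ↦ (M̃, Ñ, P, Q)`: `M̃`, `P` are even and `Ñ`, `Q` are odd. -/
def IsReversible (Y : ℝ → Fin 4 → ℝ) : Prop :=
  ∀ τ, Y (-τ) = ![Y τ 0, -(Y τ 1), Y τ 2, -(Y τ 3)]

namespace IsReversible

theorem even_amplitude (hrev : IsReversible Y) : Function.Even (amplitude μ α β ω Y) :=
  fun x => by simp [amplitude, hrev x]

theorem even_phase (hrev : IsReversible Y) : Function.Even (phase μ α β lam ω Y) := fun x => by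
  rw [phase, ← neg_zero, ← intervalIntegral.integral_comp_neg, intervalIntegral.integral_symm,
    ← intervalIntegral.integral_neg, phase]
  refine intervalIntegral.integral_congr fun s _ => ?_
  simp only [hrev s, Matrix.cons_val]
  ring

theorem periodic_phase (hrev : IsReversible Y)
    (hY : IsIntegralCurve Y fun _ => vf4 μ α β lam ω)
    (hpos : ∀ x, 0 < ampSq μ α β ω (Y x)) (hper : Function.Periodic Y T) :
    Function.Periodic (phase μ α β lam ω Y) T := by
  have hderiv (x : ℝ) : HasDerivAt
      (fun x => phase μ α β lam ω Y (x + T) - phase μ α β lam ω Y x) 0 x := by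
    refine (((hasDerivAt_phase hY hpos (x + T)).comp_add_const x T).sub
      (hasDerivAt_phase hY hpos x)).congr_deriv ?_
    rw [hper x, sub_self]
  intro x
  have h := is_const_of_deriv_eq_zero (fun x => (hderiv x).differentiableAt)
    (fun x => (hderiv x).deriv) x (-(T / 2))
  rw [hrev.even_phase, neg_add_eq_sub, sub_half, sub_self] at h
  exact sub_eq_zero.mp h

end IsReversible

theorem isStationaryMAW (h : β - α ≠ 0) (hl : lam ≠ 0)
    (hY : IsIntegralCurve Y fun _ => vf4 μ α β lam ω)
    (hpos : ∀ x, 0 < ampSq μ α β ω (Y x))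
    (hdef : ∀ τ, consistencyDefect μ α β lam ω (Y τ) = 0)
    (hT : 0 < T) (hper : Function.Periodic Y T)
    (hphase : Function.Periodic (phase μ α β lam ω Y) T)
    {x₁ x₂ : ℝ} (hne : ampSq μ α β ω (Y x₁) ≠ ampSq μ α β ω (Y x₂)) :
    IsStationaryMAW μ α β T ω (amplitude μ α β ω Y) (phase μ α β lam ω Y) where
  L_pos := hT
  smooth_R := contDiff_amplitude hY hpos
  smooth_φ := contDiff_phase hY hpos
  R_pos x := Real.sqrt_pos.mpr (hpos x)
  R_periodic := hper.comp fun y => Real.sqrt (ampSq μ α β ω y)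
  R_modulated := fun ⟨r, hr⟩ => hne <|
    (Real.sqrt_inj (hpos x₁).le (hpos x₂).le).mp ((hr x₁).trans (hr x₂).symm)
  field_periodic t x := by
    simp only [field, hphase x, amplitude, hper x]
  solves := (solvesAmplitudePhase h hl hY hpos hdef).solvesCGL_field
    fun x => Real.sqrt_pos.mpr (hpos x)

end Symmetric

theorem abs_le_of_periodic_of_abs_deriv_le {f : ℝ → ℝ} {K T : ℝ} (hf : Differentiable ℝ f)
    (hK : ∀ x, |deriv f x| ≤ K) (hT : 0 < T) (hper : Function.Periodic f T) (h0 : f 0 = 0)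
    (x : ℝ) : |f x| ≤ K * T := by
  obtain ⟨y, hy, hxy⟩ := hper.exists_mem_Ico₀ hT x
  have h := convex_univ.norm_image_sub_le_of_norm_deriv_le (fun x _ => hf x) (fun x _ => hK x)
    (Set.mem_univ 0) (Set.mem_univ y)
  rw [h0, sub_zero, sub_zero, Real.norm_eq_abs, Real.norm_eq_abs, abs_of_nonneg hy.1] at h
  rw [hxy]
  exact h.trans (mul_le_mul_of_nonneg_left hy.2.le ((abs_nonneg _).trans (hK 0)))

theorem tendstoUniformly_zero_of_periodic_of_deriv {ι : Type*} {l : Filter ι} {f : ι → ℝ → ℝ}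
    {T : ι → ℝ} {T₀ : ℝ} (hT : Filter.Tendsto T l (nhds T₀))
    (hf : ∀ᶠ i in l, Differentiable ℝ (f i) ∧ 0 < T i ∧ Function.Periodic (f i) (T i) ∧ f i 0 = 0)
    (hderiv : TendstoUniformly (fun i => deriv (f i)) (fun _ => 0) l) :
    TendstoUniformly f (fun _ => 0) l := by
  rw [Metric.tendstoUniformly_iff] at hderiv ⊢
  intro ε hε
  have hK : 0 < |T₀| + 1 := by positivity
  filter_upwards [hf, hderiv (ε / (|T₀| + 1)) (by positivity),
    hT.eventually_lt_const ((le_abs_self T₀).trans_lt (lt_add_one _))]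
    with i ⟨hd, hpos, hper, h0⟩ hi hTi x
  simp only [dist_zero_left, Real.norm_eq_abs] at hi ⊢
  calc |f i x| ≤ ε / (|T₀| + 1) * T i :=
        abs_le_of_periodic_of_abs_deriv_le hd (fun x => (hi x).le) hpos hper h0 x
    _ < ε / (|T₀| + 1) * (|T₀| + 1) := by gcongr
    _ = ε := div_mul_cancel₀ _ hK.ne'

/-! ### The wave belonging to a fixed point -/

/-- The parameters of the CGLe, the root `lam` and the amplitude `a₄`. -/
structure Params where
  μ : ℝ
  α : ℝ
  β : ℝ
  lam : ℝ
  a₄ : ℝ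

namespace Params

variable (P : Params) (ρ : ℝ) (u : PerFun × PerFun × ℝ × ℝ)

/-- The constants of the fixed point problem for the CGLe. -/
@[simps]
def reduced : Reduced where
  s := 1 + P.α * P.β
  m := 1 + P.α ^ 2
  d := coefD P.α P.β
  lam := P.lam
  a := coefA P.α P.β
  μ := P.μ
  amp := P.a₄

/-- The carrier frequency `ω`. -/
def ω : ℝ :=
  carrierFreq P.μ P.α P.β ρ (P.reduced.a₂₂ (ρ ^ 2, u)) (P.reduced.ω₃ (ρ ^ 2, u))

/-- The spatial frequency `Ω`. -/
def Ω : ℝ := spatialFreq P.μ P.α P.β P.lam (P.ω ρ u) ρ (Unknowns.γ (ρ ^ 2, u))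

/-- The solution `X = (x₁, x₂, z₁, z₂)` of the rescaled system. -/
def X : ℝ → Fin 4 → ℝ := stretch (P.Ω ρ u) (P.reduced.profile (ρ ^ 2, u) ρ)

/-- The solution `Y = (M̃, Ñ, P, Q)` of the 4-D system. -/
def Y (τ : ℝ) : Fin 4 → ℝ :=
  physical P.μ P.α P.β P.lam (P.ω ρ u) ρ (P.Ω ρ u) τ (P.X ρ u τ)

/-- The unstable regime, with `lam` and `a₄` as in the wave problem. -/
structure IsUnstable : Prop where
  μ_pos : 0 < P.μ
  one_add_mul_neg : 1 + P.α * P.β < 0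
  root : P.lam ^ 2 + coefC P.α P.β * P.lam - 2 * coefA P.α P.β * coefD P.α P.β = 0
  a₄_ne_zero : P.a₄ ≠ 0

/-- The fixed points that belong to a wave: frequencies and squared amplitude are positive, and the
leading mode is not cancelled. -/
structure IsWave : Prop extends P.IsUnstable, P.reduced.IsFixed (ρ ^ 2, u) where
  ω₁Sq_pos : 0 < P.reduced.ω₁Sq (ρ ^ 2, u)
  ΩSq_pos : 0 < P.reduced.ΩSq (ρ ^ 2, u)
  ampSqProfile_pos : ∀ x, 0 < P.reduced.ampSqProfile (ρ ^ 2, u) x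
  p_zero_ne : P.reduced.p (ρ ^ 2, u) 0 ≠ P.reduced.p (ρ ^ 2, u) Real.pi

theorem ω_eq : P.ω ρ u = detunedFreq P.μ P.α P.β ((ρ ^ 2) ^ 2 * Unknowns.σ (ρ ^ 2, u)) := by
  rw [ω, carrierFreq_eq_detunedFreq, Reduced.ω₃, ← pow_mul]
  exact congrArg (fun x => detunedFreq _ _ _ (_ * x)) (add_sub_cancel_right _ _)

variable {P ρ u}

namespace IsUnstable

variable (hP : P.IsUnstable)

include hP

theorem beta_sub_alpha_ne_zero : P.β - P.α ≠ 0 := CGL.beta_sub_alpha_ne_zero hP.one_add_mul_neg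

theorem lam_ne_zero : P.lam ≠ 0 := root_ne_zero hP.beta_sub_alpha_ne_zero hP.root

theorem coefA_ne_zero : coefA P.α P.β ≠ 0 := CGL.coefA_ne_zero hP.beta_sub_alpha_ne_zero

theorem nondeg : P.reduced.Nondeg where
  s := hP.one_add_mul_neg.ne
  m := (one_add_sq_pos P.α).ne'
  lam := hP.lam_ne_zero
  a := hP.coefA_ne_zero
  μ := hP.μ_pos.ne'
  amp := hP.a₄_ne_zero

theorem coefE_ω : coefE P.μ P.α P.β (P.ω ρ u) = P.reduced.e (ρ ^ 2, u) := by
  rw [P.ω_eq, coefE_detunedFreq hP.beta_sub_alpha_ne_zero]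
  rfl

theorem eTilde_ω :
    eTilde P.μ P.α P.β P.lam (P.ω ρ u) = P.lam * P.reduced.ω₁Sq (ρ ^ 2, u) := by
  rw [P.ω_eq, eTilde_detunedFreq hP.beta_sub_alpha_ne_zero, linFreqSq, ← P.ω_eq, hP.coefE_ω,
    ← mul_assoc 2]
  rfl

theorem eTilde_ω_div_lam :
    eTilde P.μ P.α P.β P.lam (P.ω ρ u) / P.lam = P.reduced.ω₁Sq (ρ ^ 2, u) := by
  rw [hP.eTilde_ω, mul_div_cancel_left₀ _ hP.lam_ne_zero]

theorem coefK_ω : coefK P.μ P.α P.β P.lam (P.ω ρ u) = P.reduced.k (ρ ^ 2, u) := by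
  rw [coefK, hP.coefE_ω, hP.eTilde_ω]
  rfl

theorem Ω_eq : P.Ω ρ u = P.reduced.Ω (ρ ^ 2, u) := by
  rw [Ω, spatialFreq, hP.eTilde_ω_div_lam]
  rfl

end IsUnstable

theorem rescaledVF_eq {μ α β lam ω ρ γ Ω τ y z zt : ℝ} {v : Fin 4 → ℝ}
    (hzt : v 2 * Real.sin (Ω * τ) + v 3 * Real.cos (Ω * τ) = zt) (hz : ρ * v 1 + zt = z)
    (hy : v 0 - coefK μ α β lam ω * (Ω * lam / eTilde μ α β lam ω)
      * (v 2 * Real.cos (Ω * τ) - v 3 * Real.sin (Ω * τ)) = y) :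
    rescaledVF μ α β lam ω ρ γ Ω τ v =
      ![ρ * lam * coefE μ α β ω / coefA α β * v 1
          - ρ ^ 2 * coefK μ α β lam ω * (coefD α β / eTilde μ α β lam ω) * z ^ 2,
        ρ / eTilde μ α β lam ω * y * z,
        ρ ^ 2 / Ω * (-coefD α β / lam * z ^ 2 * Real.cos (Ω * τ) + γ * zt * Real.cos (Ω * τ)
          - Ω / eTilde μ α β lam ω * y * z * Real.sin (Ω * τ)),
        ρ ^ 2 / Ω * (coefD α β / lam * z ^ 2 * Real.sin (Ω * τ) - γ * zt * Real.sin (Ω * τ)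
          - Ω / eTilde μ α β lam ω * y * z * Real.cos (Ω * τ))] := by
  simp only [rescaledVF, hzt, hz, hy]

theorem X_zero (τ : ℝ) : P.X ρ u τ 0 = (P.reduced.Ω (ρ ^ 2, u))⁻¹
      * P.reduced.n (ρ ^ 2, u) (P.Ω ρ u * τ : ℝ)
    + P.reduced.k (ρ ^ 2, u) * P.reduced.Ω (ρ ^ 2, u) / P.reduced.ω₁Sq (ρ ^ 2, u)
      * P.reduced.q (ρ ^ 2, u) (P.Ω ρ u * τ : ℝ) := rfl

theorem X_one (τ : ℝ) : P.X ρ u τ 1 =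
    ρ / (P.lam * P.reduced.ω₁Sq (ρ ^ 2, u)) * Unknowns.h (ρ ^ 2, u) (P.Ω ρ u * τ : ℝ) := rfl

theorem X_two_mul_sin_add (τ : ℝ) :
    P.X ρ u τ 2 * Real.sin (P.Ω ρ u * τ) + P.X ρ u τ 3 * Real.cos (P.Ω ρ u * τ)
      = P.reduced.zTilde (ρ ^ 2, u) (P.Ω ρ u * τ : ℝ) :=
  DFunLike.congr_fun (Reduced.zTilde_mul_sin_add ρ) ((P.Ω ρ u * τ : ℝ) : Real.Angle)

theorem X_two_mul_cos_sub (τ : ℝ) :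
    P.X ρ u τ 2 * Real.cos (P.Ω ρ u * τ) - P.X ρ u τ 3 * Real.sin (P.Ω ρ u * τ)
      = P.reduced.q (ρ ^ 2, u) (P.Ω ρ u * τ : ℝ) :=
  DFunLike.congr_fun (Reduced.q_eq_mul_cos_sub ρ) ((P.Ω ρ u * τ : ℝ) : Real.Angle)

theorem mul_X_one_add (τ : ℝ) :
    ρ * P.X ρ u τ 1 + P.reduced.zTilde (ρ ^ 2, u) (P.Ω ρ u * τ : ℝ)
      = P.reduced.p (ρ ^ 2, u) (P.Ω ρ u * τ : ℝ) := by
  simp only [X_one, Reduced.zTilde, ContinuousMap.sub_apply, ContinuousMap.smul_apply, smul_eq_mul]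
  change _ + (_ - ρ ^ 2 / (P.lam * _) * _) = _
  ring

namespace IsWave

variable (hw : P.IsWave ρ u)

include hw

theorem Ω_pos : 0 < P.Ω ρ u := hw.Ω_eq ▸ Real.sqrt_pos.mpr hw.ΩSq_pos

theorem Ω_sq : P.Ω ρ u ^ 2 = P.reduced.ΩSq (ρ ^ 2, u) :=
  hw.Ω_eq ▸ Real.sq_sqrt hw.ΩSq_pos.le

theorem X_zero_sub (τ : ℝ) :
    P.X ρ u τ 0 - coefK P.μ P.α P.β P.lam (P.ω ρ u)
        * (P.Ω ρ u * P.lam / eTilde P.μ P.α P.β P.lam (P.ω ρ u))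
        * (P.X ρ u τ 2 * Real.cos (P.Ω ρ u * τ) - P.X ρ u τ 3 * Real.sin (P.Ω ρ u * τ))
      = (P.Ω ρ u)⁻¹ * P.reduced.n (ρ ^ 2, u) (P.Ω ρ u * τ : ℝ) := by
  have hl := hw.lam_ne_zero
  have hω := hw.ω₁Sq_pos.ne'
  rw [X_two_mul_cos_sub, X_zero, hw.coefK_ω, hw.eTilde_ω, hw.Ω_eq]
  field_simp
  ring

theorem rescaledVF_X (τ : ℝ) :
    rescaledVF P.μ P.α P.β P.lam (P.ω ρ u) ρ (Unknowns.γ (ρ ^ 2, u)) (P.Ω ρ u) τ (P.X ρ u τ)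
      = P.Ω ρ u • stretch (P.Ω ρ u) (P.reduced.profileDeriv (ρ ^ 2, u) ρ) τ := by
  have hl := hw.lam_ne_zero
  have ha := hw.coefA_ne_zero
  have hω := hw.ω₁Sq_pos.ne'
  have hΩ := hw.Ω_pos.ne'
  rw [rescaledVF_eq (X_two_mul_sin_add τ) (mul_X_one_add τ) (hw.X_zero_sub τ), hw.coefE_ω,
    hw.coefK_ω, hw.eTilde_ω, X_one]
  funext i
  fin_cases i <;>
    simp only [stretch, Reduced.profileDeriv, ← hw.Ω_sq, ← hw.Ω_eq, reduced_lam, reduced_a,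
      reduced_d, Pi.smul_apply, Fin.zero_eta, Fin.mk_one, Fin.reduceFinMk, Matrix.cons_val,
      ContinuousMap.add_apply, ContinuousMap.sub_apply, ContinuousMap.smul_apply,
      ContinuousMap.mul_apply, cos_apply, sin_apply, Real.Angle.cos_coe, Real.Angle.sin_coe,
      smul_eq_mul] <;>
    field_simp <;>
    ring

theorem hasDerivAt_X (τ : ℝ) :
    HasDerivAt (P.X ρ u) (rescaledVF P.μ P.α P.β P.lam (P.ω ρ u) ρ (Unknowns.γ (ρ ^ 2, u)) (P.Ω ρ u)
      τ (P.X ρ u τ)) τ := by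
  rw [hw.rescaledVF_X]
  exact hasDerivAt_stretch (hw.hasDeriv_profile ρ hw.ΩSq_pos) τ

theorem periodic_X : Function.Periodic (P.X ρ u) (2 * Real.pi / P.Ω ρ u) :=
  periodic_stretch hw.Ω_pos.ne' _

theorem reflQ_mulVec_X_neg (τ : ℝ) : reflQ.mulVec (P.X ρ u (-τ)) = P.X ρ u τ := by
  have h₀ := stretch_neg_of_odd (Ω := P.Ω ρ u) (P.reduced.odd_profile_zero (ρ ^ 2, u) ρ) τ
  have h₁ := stretch_neg_of_even (Ω := P.Ω ρ u) (hw.even_profile_one ρ) τ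
  have h₂ := stretch_neg_of_odd (Ω := P.Ω ρ u) (hw.odd_profile_two ρ) τ
  have h₃ := stretch_neg_of_even (Ω := P.Ω ρ u) (hw.even_profile_three ρ) τ
  funext i
  fin_cases i <;> simp [reflQ, Matrix.mulVec_diagonal, X, h₀, h₁, h₂, h₃]

theorem mean_X (i : Fin 4) :
    mean (2 * Real.pi / P.Ω ρ u) (fun τ => P.X ρ u τ i)
      = ![0, ρ * P.reduced.a₂₂ (ρ ^ 2, u), 0, P.a₄] i := by
  rw [← P.reduced_amp, ← hw.avg_profile ρ i]
  exact mean_comp_mul hw.Ω_pos.ne' _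

theorem Y_eq : P.Y ρ u = stretch (P.Ω ρ u) (P.reduced.orbit (ρ ^ 2, u)) := by
  have hl := hw.lam_ne_zero
  have hω := hw.ω₁Sq_pos.ne'
  funext τ
  have hq : P.Ω ρ u * P.X ρ u τ 2 * Real.cos (P.Ω ρ u * τ)
      - P.Ω ρ u * P.X ρ u τ 3 * Real.sin (P.Ω ρ u * τ)
        = P.Ω ρ u * P.reduced.q (ρ ^ 2, u) (P.Ω ρ u * τ : ℝ) := by
    rw [← X_two_mul_cos_sub]
    ring
  have hn := hw.X_zero_sub τ
  rw [X_two_mul_cos_sub] at hn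
  rw [Y, physical_eq, X_two_mul_sin_add, mul_X_one_add, hq, X_one, hw.eTilde_ω]
  funext i
  fin_cases i <;>
    simp only [stretch, Reduced.orbit, ← hw.Ω_eq, Fin.zero_eta, Fin.mk_one, Fin.reduceFinMk,
      Matrix.cons_val, ContinuousMap.smul_apply, smul_eq_mul]
  · field_simp
  · rw [hw.eTilde_ω] at hn
    linear_combination ρ ^ 2 * hn
  · ring

theorem isIntegralCurve_Y :
    IsIntegralCurve (P.Y ρ u) fun _ => vf4 P.μ P.α P.β P.lam (P.ω ρ u) := by
  have hl := hw.lam_ne_zero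
  have hΩ := hw.Ω_pos.ne'
  have hω₁ : P.reduced.ω₁Sq (ρ ^ 2, u) = P.Ω ρ u ^ 2 - ρ ^ 2 * Unknowns.γ (ρ ^ 2, u) := by
    rw [hw.Ω_sq, Reduced.ΩSq, add_sub_cancel_right]
  intro τ
  rw [hw.Y_eq]
  refine (hasDerivAt_stretch hw.hasDeriv_orbit τ).congr_deriv (funext fun i => ?_)
  fin_cases i <;>
    simp only [vf4, stretch, Reduced.orbit, Reduced.orbitDeriv, hw.coefK_ω, hw.eTilde_ω,
      ← hw.Ω_eq, ← hw.Ω_sq, hw.forcing_eq, hw.quad_eq, reduced_lam, reduced_a, reduced_d, hω₁,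
      Pi.smul_apply, Fin.zero_eta, Fin.mk_one, Fin.reduceFinMk, Matrix.cons_val,
      ContinuousMap.add_apply, ContinuousMap.sub_apply, ContinuousMap.smul_apply,
      ContinuousMap.mul_apply, smul_eq_mul] <;>
    field_simp
  · ring

theorem periodic_Y : Function.Periodic (P.Y ρ u) (2 * Real.pi / P.Ω ρ u) :=
  hw.Y_eq ▸ periodic_stretch hw.Ω_pos.ne' _

theorem isReversible_Y : IsReversible (P.Y ρ u) := fun τ => by
  have h₀ := stretch_neg_of_even (Ω := P.Ω ρ u) hw.even_orbit_zero τ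
  have h₁ := stretch_neg_of_odd (Ω := P.Ω ρ u) (P.reduced.odd_orbit_one (ρ ^ 2, u)) τ
  have h₂ := stretch_neg_of_even (Ω := P.Ω ρ u) hw.even_orbit_two τ
  have h₃ := stretch_neg_of_odd (Ω := P.Ω ρ u) (P.reduced.odd_orbit_three (ρ ^ 2, u)) τ
  rw [hw.Y_eq]
  funext i
  fin_cases i <;> simp [h₀, h₁, h₂, h₃]

theorem ampSq_Y (τ : ℝ) : ampSq P.μ P.α P.β (P.ω ρ u) (P.Y ρ u τ)
    = P.reduced.ampSqProfile (ρ ^ 2, u) (P.Ω ρ u * τ : ℝ) := by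
  rw [ampSq, hw.coefE_ω, hw.Y_eq]
  simp [stretch, Reduced.orbit, Reduced.ampSqProfile, mul_assoc]

theorem ampSq_Y_pos (τ : ℝ) : 0 < ampSq P.μ P.α P.β (P.ω ρ u) (P.Y ρ u τ) :=
  hw.ampSq_Y τ ▸ hw.ampSqProfile_pos _

theorem consistencyDefect_Y_zero :
    consistencyDefect P.μ P.α P.β P.lam (P.ω ρ u) (P.Y ρ u 0) = 0 := by
  have hN : P.Y ρ u 0 1 = 0 := by
    have h := congrFun (hw.isReversible_Y 0) 1
    rw [neg_zero] at h
    exact self_eq_neg.mp h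
  have hQ : P.Y ρ u 0 3 = 0 := by
    have h := congrFun (hw.isReversible_Y 0) 3
    rw [neg_zero] at h
    exact self_eq_neg.mp h
  have hM : P.Y ρ u 0 0 = (ρ ^ 2) ^ 2 * Unknowns.h (ρ ^ 2, u) 0 := by
    simp [hw.Y_eq, stretch, Reduced.orbit]
  have hp : P.Y ρ u 0 2 = ρ ^ 2 * P.reduced.p (ρ ^ 2, u) 0 := by
    simp [hw.Y_eq, stretch, Reduced.orbit]
  have h := hw.consistency_at_zero
  simp only [reduced_s, reduced_m, reduced_d, reduced_lam] at h
  set p := P.reduced.p (ρ ^ 2, u) 0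
  rw [consistencyDefect, hN, hQ, P.ω_eq,
    bigM_detunedFreq hw.beta_sub_alpha_ne_zero hw.lam_ne_zero _ _ _ _ _ hM hp, hQ, ← P.ω_eq,
    hw.coefE_ω]
  linear_combination -(1 + P.α ^ 2) * (ρ ^ 2) ^ 2
    * (coefD P.α P.β * (ρ ^ 2 * p) + P.reduced.e (ρ ^ 2, u)) * h

theorem consistencyDefect_Y (τ : ℝ) :
    consistencyDefect P.μ P.α P.β P.lam (P.ω ρ u) (P.Y ρ u τ) = 0 :=
  (consistencyDefect_const hw.beta_sub_alpha_ne_zero hw.root hw.isIntegralCurve_Y τ 0).trans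
    hw.consistencyDefect_Y_zero

theorem periodic_phase :
    Function.Periodic (phase P.μ P.α P.β P.lam (P.ω ρ u) (P.Y ρ u)) (2 * Real.pi / P.Ω ρ u) :=
  hw.isReversible_Y.periodic_phase hw.isIntegralCurve_Y hw.ampSq_Y_pos hw.periodic_Y

theorem finrank_eigenspace_linPart :
    Module.finrank ℝ (Module.End.eigenspace
      (Matrix.toLin' (linPart P.μ P.α P.β P.lam (P.ω ρ u))) 0) = 1 :=
  CGL.finrank_eigenspace_linPart hw.lam_ne_zero hw.coefA_ne_zero (hw.coefE_ω ▸ hw.e)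

theorem solvesAmplitudePhase :
    SolvesAmplitudePhase P.μ P.α P.β (P.ω ρ u) (amplitude P.μ P.α P.β (P.ω ρ u) (P.Y ρ u))
      (phase P.μ P.α P.β P.lam (P.ω ρ u) (P.Y ρ u)) :=
  CGL.solvesAmplitudePhase hw.beta_sub_alpha_ne_zero hw.lam_ne_zero hw.isIntegralCurve_Y
    hw.ampSq_Y_pos hw.consistencyDefect_Y

theorem isStationaryMAW (hρ : ρ ≠ 0) :
    IsStationaryMAW P.μ P.α P.β (2 * Real.pi / P.Ω ρ u) (P.ω ρ u)
      (amplitude P.μ P.α P.β (P.ω ρ u) (P.Y ρ u))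
      (phase P.μ P.α P.β P.lam (P.ω ρ u) (P.Y ρ u)) := by
  refine CGL.isStationaryMAW hw.beta_sub_alpha_ne_zero hw.lam_ne_zero hw.isIntegralCurve_Y
    hw.ampSq_Y_pos hw.consistencyDefect_Y (div_pos Real.two_pi_pos hw.Ω_pos) hw.periodic_Y
    hw.periodic_phase (x₁ := 0) (x₂ := Real.pi / P.Ω ρ u) ?_
  rw [hw.ampSq_Y, hw.ampSq_Y, mul_zero, mul_div_cancel₀ _ hw.Ω_pos.ne']
  have hdε : coefD P.α P.β * ρ ^ 2 ≠ 0 :=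
    mul_ne_zero (coefD_ne_zero hw.beta_sub_alpha_ne_zero) (pow_ne_zero 2 hρ)
  simpa [Reduced.ampSqProfile, hdε] using hw.p_zero_ne

end IsWave

end Params

/-! ### Continuity of the profiles -/

namespace Reduced

variable {c : Reduced} {z : Unknowns}

theorem continuous_Ω : Continuous c.Ω := c.contDiff_ΩSq.continuous.sqrt

theorem continuous_ampSqProfile : Continuous c.ampSqProfile := by
  have hp := (c.contDiff_p).continuous
  have he := (c.contDiff_e).continuous
  unfold ampSqProfile
  fun_prop

theorem IsRegular.continuousAt_a₂₂ (hz : c.IsRegular z) : ContinuousAt c.a₂₂ z :=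
  hz.contDiffAt_hMean.continuousAt.div (c.contDiff_ω₁Sq.continuous.const_mul c.lam).continuousAt
    (mul_ne_zero hz.lam hz.ω₁Sq)

theorem IsRegular.continuousAt_ω₃ (hz : c.IsRegular z) : ContinuousAt c.ω₃ z := by
  have h := hz.continuousAt_a₂₂
  unfold ω₃
  fun_prop

theorem IsRegular.continuousAt_orbit (hz : c.IsRegular z) (hΩ : c.Ω z ≠ 0) :
    ContinuousAt c.orbit z := by
  have h₁ := (c.continuous_Ω).continuousAt (x := z)
  have h₂ := hz.contDiffAt_q.continuousAt
  have h₃ := (c.contDiff_n).continuous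
  have h₄ := (c.contDiff_p).continuous
  refine continuousAt_pi.mpr fun i => ?_
  fin_cases i <;> simp only [orbit, Fin.zero_eta, Fin.mk_one, Fin.reduceFinMk, Matrix.cons_val] <;>
    fun_prop (disch := assumption)

theorem IsRegular.continuousAt_profile (hz : c.IsRegular z) (hΩ : c.Ω z ≠ 0) (ρ : ℝ) :
    ContinuousAt (fun w : ℝ × Unknowns => c.profile w.2 w.1) (ρ, z) := by
  have h₁ := (c.continuous_Ω).continuousAt (x := z)
  have h₂ := hz.contDiffAt_q.continuousAt
  have h₃ := (c.contDiff_n).continuous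
  have h₄ := (c.contDiff_p).continuous
  have h₅ := (c.contDiff_k).continuous
  have h₆ := (c.contDiff_ω₁Sq).continuous
  have hω := hz.ω₁Sq
  have hlω := mul_ne_zero hz.lam hz.ω₁Sq
  refine continuousAt_pi.mpr fun i => ?_
  fin_cases i <;>
    simp only [profile, zTilde, Fin.zero_eta, Fin.mk_one, Fin.reduceFinMk, Matrix.cons_val] <;>
    fun_prop (disch := assumption)

variable (u : PerFun × PerFun × ℝ × ℝ)

theorem ampSqProfile_zero : c.ampSqProfile (0, u) = c.μ • 1 := by
  simp [ampSqProfile, e_zero]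

theorem orbit_zero : c.orbit (0, u) = 0 := by
  funext i
  fin_cases i <;> simp [orbit]

theorem profile_zero (hΩ : 0 < c.ΩSq (0, u)) :
    c.profile (0, u) 0 = fun i => ![0, 0, 0, c.amp] i • 1 := by
  have hω : c.ω₁Sq (0, u) = c.Ω (0, u) ^ 2 := by
    rw [Ω, Real.sq_sqrt hΩ.le, ΩSq_zero, ω₁Sq_zero]
  have hz : c.zTilde (0, u) = c.amp • cos := by simp [zTilde, p_zero]
  funext i
  fin_cases i <;>
    simp only [profile, n_zero, q_zero, hz, hω, Fin.zero_eta, Fin.mk_one, Fin.reduceFinMk,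
      Matrix.cons_val]
  · rw [smul_neg, smul_smul, smul_smul, ← sub_eq_add_neg, ← sub_smul]
    field_simp
    simp
  · simp
  · simp [mul_comm cos sin]
  · rw [← cos_mul_cos_add_sin_mul_sin, smul_add, smul_mul_assoc, neg_mul, smul_mul_assoc,
      sub_neg_eq_add]

end Reduced

/-! ### The branch of waves -/

namespace Params

/-- A family of unknowns that, for `|ρ| < ρ₀`, is continuous and belongs to waves. -/
structure IsBranch (P : Params) (u : ℝ → PerFun × PerFun × ℝ × ℝ) (ρ₀ : ℝ) : Prop where
  pos : 0 < ρ₀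
  continuousAt : ∀ ρ ∈ Set.Ioo (-ρ₀) ρ₀, ContinuousAt u ρ
  isWave : ∀ ρ ∈ Set.Ioo (-ρ₀) ρ₀, P.IsWave ρ (u ρ)

variable {P : Params} {u : ℝ → PerFun × PerFun × ℝ × ℝ}

namespace IsUnstable

variable (hP : P.IsUnstable)

include hP

theorem ω₁Sq_zero_pos (v : PerFun × PerFun × ℝ × ℝ) : 0 < P.reduced.ω₁Sq (0, v) := by
  rw [Reduced.ω₁Sq_zero]
  refine mul_pos (neg_pos.mpr (div_neg_of_neg_of_pos ?_ (one_add_sq_pos P.α))) hP.μ_pos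
  exact mul_neg_of_pos_of_neg two_pos hP.one_add_mul_neg

theorem eventually_ampSqProfile_pos (v : PerFun × PerFun × ℝ × ℝ) :
    ∀ᶠ z in nhds (0, v), ∀ x, 0 < P.reduced.ampSqProfile z x := by
  have hopen : IsOpen {f : PerFun | Set.MapsTo f Set.univ (Set.Ioi 0)} :=
    ContinuousMap.isOpen_setOfPred_mapsTo isCompact_univ isOpen_Ioi
  have hmem : P.reduced.ampSqProfile (0, v) ∈ {f : PerFun | Set.MapsTo f Set.univ (Set.Ioi 0)} :=
    fun x _ => by simpa [Reduced.ampSqProfile_zero] using hP.μ_pos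
  filter_upwards [Reduced.continuous_ampSqProfile.continuousAt.eventually_mem (hopen.mem_nhds hmem)]
    with z hz x using hz (Set.mem_univ x)

theorem eventually_p_zero_ne (v : PerFun × PerFun × ℝ × ℝ) :
    ∀ᶠ z in nhds (0, v), P.reduced.p z 0 ≠ P.reduced.p z Real.pi := by
  have hp : Continuous P.reduced.p := Reduced.contDiff_p.continuous
  refine (ContinuousAt.ne_iff_eventually_ne (by fun_prop) (by fun_prop)).mp ?_
  simp [Reduced.p_zero, self_eq_neg, hP.a₄_ne_zero]

theorem eventually_isWave (hu : ContinuousAt u 0)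
    (hfix : ∀ᶠ ρ in nhds 0, P.reduced.fixedPointMap (ρ ^ 2, u ρ) = u ρ) :
    ∀ᶠ ρ in nhds 0, P.IsWave ρ (u ρ) := by
  have hz : Filter.Tendsto (fun ρ => ((ρ ^ 2, u ρ) : Unknowns)) (nhds 0) (nhds (0, u 0)) := by
    have h : ContinuousAt (fun ρ => ((ρ ^ 2, u ρ) : Unknowns)) 0 := by fun_prop
    simpa [ContinuousAt] using h
  have hω₀ := hP.ω₁Sq_zero_pos (u 0)
  have he : ∀ᶠ z in nhds (0, u 0), 0 < P.reduced.e z :=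
    Reduced.contDiff_e.continuous.continuousAt.eventually_const_lt
      (by rw [Reduced.e_zero]; exact hP.μ_pos)
  have hω : ∀ᶠ z in nhds (0, u 0), 0 < P.reduced.ω₁Sq z :=
    Reduced.contDiff_ω₁Sq.continuous.continuousAt.eventually_const_lt hω₀
  have hΩ : ∀ᶠ z in nhds (0, u 0), 0 < P.reduced.ΩSq z :=
    Reduced.contDiff_ΩSq.continuous.continuousAt.eventually_const_lt
      (by rwa [Reduced.ΩSq_zero, ← Reduced.ω₁Sq_zero])
  filter_upwards [hfix, hz.eventually he, hz.eventually hω, hz.eventually hΩ,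
    hz.eventually (hP.eventually_ampSqProfile_pos _), hz.eventually (hP.eventually_p_zero_ne _)]
    with ρ hfix he hω hΩ hamp hp
  exact ⟨hP, ⟨⟨hP.nondeg, he.ne', hω.ne', hΩ.ne'⟩, hfix⟩, hω, hΩ, hamp, hp⟩

theorem exists_branch : ∃ u ρ₀, P.IsBranch u ρ₀ := by
  obtain ⟨v, hv⟩ := hP.nondeg.exists_branch
  have hsq : Filter.Tendsto (fun ρ : ℝ => ρ ^ 2) (nhds 0) (nhds 0) := by
    have h : ContinuousAt (fun ρ : ℝ => ρ ^ 2) 0 := by fun_prop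
    simpa [ContinuousAt] using h
  have hu : ∀ᶠ ρ in nhds 0, ContinuousAt (fun ρ => v (ρ ^ 2)) ρ :=
    (hsq.eventually hv).mono fun ρ h => ContinuousAt.comp' h.1 (continuousAt_id.pow 2)
  have hw := hP.eventually_isWave hu.self_of_nhds ((hsq.eventually hv).mono fun ρ h => h.2)
  obtain ⟨ρ₀, hρ₀, h⟩ := Metric.eventually_nhds_iff_ball.mp (hu.and hw)
  rw [Real.ball_eq_Ioo, zero_sub, zero_add] at h
  exact ⟨fun ρ => v (ρ ^ 2), ρ₀, hρ₀, fun ρ hρ => (h ρ hρ).1, fun ρ hρ => (h ρ hρ).2⟩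

end IsUnstable

end Params

/-! ### Continuity and limits along the branch -/

namespace Params

variable {P : Params} {u : ℝ → PerFun × PerFun × ℝ × ℝ} {ρ : ℝ}

namespace IsWave

variable (hw : P.IsWave ρ (u ρ)) (hu : ContinuousAt u ρ)

include hw hu

theorem continuousAt_a₂₂ : ContinuousAt (fun ρ => P.reduced.a₂₂ (ρ ^ 2, u ρ)) ρ :=
  ContinuousAt.comp' (f := fun ρ => ((ρ ^ 2, u ρ) : Unknowns)) hw.toIsRegular.continuousAt_a₂₂
    (by fun_prop)

theorem continuousAt_ω₃ : ContinuousAt (fun ρ => P.reduced.ω₃ (ρ ^ 2, u ρ)) ρ :=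
  ContinuousAt.comp' (f := fun ρ => ((ρ ^ 2, u ρ) : Unknowns)) hw.toIsRegular.continuousAt_ω₃
    (by fun_prop)

theorem continuousAt_Ω : ContinuousAt (fun ρ => P.Ω ρ (u ρ)) ρ := by
  simp only [hw.Ω_eq]
  have h := (Reduced.continuous_Ω (c := P.reduced))
  fun_prop

theorem continuousAt_profile :
    ContinuousAt (fun ρ => P.reduced.profile (ρ ^ 2, u ρ) ρ) ρ :=
  ContinuousAt.comp' (f := fun ρ => ((ρ, ρ ^ 2, u ρ) : ℝ × Unknowns))
    (hw.toIsRegular.continuousAt_profile (hw.Ω_eq ▸ hw.Ω_pos.ne') ρ) (by fun_prop)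

theorem continuousAt_X (τ : ℝ) :
    ContinuousAt (fun q : ℝ × ℝ => P.X q.1 (u q.1) q.2) (ρ, τ) :=
  continuousAt_stretch (hw.continuousAt_Ω hu) (hw.continuousAt_profile hu) τ

end IsWave

namespace IsBranch

variable {ρ₀ : ℝ} (hb : P.IsBranch u ρ₀)

include hb

theorem continuousOn_a₂₂ :
    ContinuousOn (fun ρ => P.reduced.a₂₂ (ρ ^ 2, u ρ)) (Set.Ioo (-ρ₀) ρ₀) :=
  fun ρ hρ => ((hb.isWave ρ hρ).continuousAt_a₂₂ (hb.continuousAt ρ hρ)).continuousWithinAt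

theorem continuousOn_γ : ContinuousOn (fun ρ => Unknowns.γ (ρ ^ 2, u ρ)) (Set.Ioo (-ρ₀) ρ₀) :=
  fun ρ hρ => (hb.continuousAt ρ hρ).snd.snd.fst.continuousWithinAt

theorem continuousOn_ω₃ :
    ContinuousOn (fun ρ => P.reduced.ω₃ (ρ ^ 2, u ρ)) (Set.Ioo (-ρ₀) ρ₀) :=
  fun ρ hρ => ((hb.isWave ρ hρ).continuousAt_ω₃ (hb.continuousAt ρ hρ)).continuousWithinAt

theorem continuousOn_X :
    ContinuousOn (fun q : ℝ × ℝ => P.X q.1 (u q.1) q.2) (Set.Ioo (-ρ₀) ρ₀ ×ˢ Set.univ) :=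
  fun q hq =>
    ((hb.isWave q.1 hq.1).continuousAt_X (hb.continuousAt q.1 hq.1) q.2).continuousWithinAt

theorem continuousAt_zero : ContinuousAt u 0 :=
  hb.continuousAt 0 ⟨neg_lt_zero.mpr hb.pos, hb.pos⟩

theorem isWave_zero : P.IsWave 0 (u 0) := hb.isWave 0 ⟨neg_lt_zero.mpr hb.pos, hb.pos⟩

theorem eventually_isWave : ∀ᶠ ρ in nhds 0, P.IsWave ρ (u ρ) :=
  Filter.eventually_of_mem (Ioo_mem_nhds (neg_lt_zero.mpr hb.pos) hb.pos) hb.isWave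

theorem tendstoUniformly_X :
    TendstoUniformly (fun ρ => P.X ρ (u ρ)) (fun _ => ![0, 0, 0, P.a₄]) (nhds 0) := by
  have h := hb.isWave_zero.continuousAt_profile hb.continuousAt_zero
  have hΩ := hb.isWave_zero.ΩSq_pos
  rw [ContinuousAt] at h
  rw [zero_pow two_ne_zero] at h hΩ
  rw [Reduced.profile_zero _ hΩ] at h
  exact tendsto_prod_top_iff.mp (tendsto_stretch (Ω := fun ρ => P.Ω ρ (u ρ)) h)

theorem tendsto_ω : Filter.Tendsto (fun ρ => P.ω ρ (u ρ)) (nhds 0) (nhds (P.μ * P.β)) := by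
  have hu := hb.continuousAt_zero
  have h : ContinuousAt (fun ρ => detunedFreq P.μ P.α P.β ((ρ ^ 2) ^ 2 * Unknowns.σ (ρ ^ 2, u ρ)))
      0 := by
    unfold detunedFreq
    fun_prop
  simpa [ContinuousAt, ω_eq] using h

theorem tendsto_coefE :
    Filter.Tendsto (fun ρ => coefE P.μ P.α P.β (P.ω ρ (u ρ))) (nhds 0) (nhds P.μ) := by
  have h : Continuous (coefE P.μ P.α P.β) := by
    unfold coefE
    fun_prop
  simpa only [Function.comp_def, coefE_base hb.isWave_zero.beta_sub_alpha_ne_zero] using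
    (h.tendsto _).comp hb.tendsto_ω

theorem tendsto_Ω : Filter.Tendsto (fun ρ => P.Ω ρ (u ρ)) (nhds 0)
    (nhds (Real.sqrt (-(2 * P.μ * (1 + P.α * P.β)) / (1 + P.α ^ 2)))) := by
  have h := hb.isWave_zero.continuousAt_Ω hb.continuousAt_zero
  rw [ContinuousAt, hb.isWave_zero.Ω_eq, Reduced.Ω, zero_pow two_ne_zero, Reduced.ΩSq_zero] at h
  convert h using 3
  simp only [reduced_s, reduced_m, reduced_μ]
  ring

theorem tendsto_Y : Filter.Tendsto (fun q : ℝ × ℝ => P.Y q.1 (u q.1) q.2) (nhds 0 ×ˢ ⊤)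
    (nhds 0) := by
  have hw := hb.isWave_zero
  have hu := hb.continuousAt_zero
  have h : Filter.Tendsto (fun ρ => P.reduced.orbit (ρ ^ 2, u ρ)) (nhds 0)
      (nhds fun i => (0 : Fin 4 → ℝ) i • 1) := by
    have h : ContinuousAt (fun ρ => P.reduced.orbit (ρ ^ 2, u ρ)) 0 :=
      ContinuousAt.comp' (f := fun ρ => ((ρ ^ 2, u ρ) : Unknowns))
        (hw.toIsRegular.continuousAt_orbit (hw.Ω_eq ▸ hw.Ω_pos.ne')) (by fun_prop)
    rw [ContinuousAt, zero_pow two_ne_zero, Reduced.orbit_zero] at h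
    exact h.trans_eq (by simp [Pi.zero_def])
  refine (tendsto_stretch (Ω := fun ρ => P.Ω ρ (u ρ)) h).congr' ?_
  filter_upwards [hb.eventually_isWave.prod_inl ⊤] with q hq
  rw [hq.Y_eq]

theorem tendsto_ampSq :
    Filter.Tendsto (fun q : ℝ × ℝ => ampSq P.μ P.α P.β (P.ω q.1 (u q.1)) (P.Y q.1 (u q.1) q.2))
      (nhds 0 ×ˢ ⊤) (nhds P.μ) := by
  simpa [ampSq] using ((tendsto_pi_nhds.mp hb.tendsto_Y 2).const_mul (coefD P.α P.β)).add
    (hb.tendsto_coefE.comp Filter.tendsto_fst)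

theorem tendstoUniformly_amplitude :
    TendstoUniformly (fun ρ => amplitude P.μ P.α P.β (P.ω ρ (u ρ)) (P.Y ρ (u ρ)))
      (fun _ => Real.sqrt P.μ) (nhds 0) :=
  tendsto_prod_top_iff.mp hb.tendsto_ampSq.sqrt

theorem tendstoUniformly_deriv_phase :
    TendstoUniformly (fun ρ => deriv (phase P.μ P.α P.β P.lam (P.ω ρ (u ρ)) (P.Y ρ (u ρ))))
      (fun _ => 0) (nhds 0) := by
  have hmom : Continuous (momentum P.α P.β P.lam) := by
    unfold momentum
    fun_prop
  have hzero : momentum P.α P.β P.lam 0 / P.μ = 0 := by simp [momentum]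
  have h := ((hmom.tendsto 0).comp hb.tendsto_Y).div hb.tendsto_ampSq hb.isWave_zero.μ_pos.ne'
  rw [hzero] at h
  refine tendsto_prod_top_iff.mp (h.congr' ?_)
  filter_upwards [hb.eventually_isWave.prod_inl ⊤] with q hq
  exact (hasDerivAt_phase hq.isIntegralCurve_Y hq.ampSq_Y_pos q.2).deriv.symm

theorem tendstoUniformly_phase :
    TendstoUniformly (fun ρ => phase P.μ P.α P.β P.lam (P.ω ρ (u ρ)) (P.Y ρ (u ρ)))
      (fun _ => 0) (nhds 0) := by
  have hΩ := hb.isWave_zero.continuousAt_Ω hb.continuousAt_zero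
  refine tendstoUniformly_zero_of_periodic_of_deriv
    (tendsto_const_nhds.div hΩ.tendsto hb.isWave_zero.Ω_pos.ne')
    (hb.eventually_isWave.mono fun ρ hw => ⟨?_, div_pos Real.two_pi_pos hw.Ω_pos,
      hw.periodic_phase, intervalIntegral.integral_same⟩) hb.tendstoUniformly_deriv_phase
  exact fun x => (hasDerivAt_phase hw.isIntegralCurve_Y hw.ampSq_Y_pos x).differentiableAt

theorem determiningMap_zero :
    determiningMap P.μ P.α P.β P.lam P.a₄ ![P.reduced.a₂₂ (0 ^ 2, u 0),
      Unknowns.γ (0 ^ 2, u 0), P.reduced.ω₃ (0 ^ 2, u 0)] = 0 := by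
  have hw := hb.isWave_zero
  have h := hw.beta_sub_alpha_ne_zero
  have hl := hw.lam_ne_zero
  have hsq := root_sq hw.root
  have hd := coefD_ne_zero h
  have hm := (one_add_sq_pos P.α).ne'
  have hs := hw.one_add_mul_neg.ne
  have hμ := hw.μ_pos.ne'
  rw [Reduced.ω₃, hw.γ_eq, hw.σ_eq, zero_pow two_ne_zero, Reduced.a₂₂, Reduced.nextσ_zero,
    Reduced.nextγ_zero, Reduced.hMean_zero, Reduced.ω₁Sq_zero, Reduced.ΩSq_zero, Reduced.k_zero]
  simp only [determiningMap, coefK, coefE_base h, eTilde_base h, linFreqSq_zero h, coefA_eq,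
    reduced_s, reduced_m, reduced_d, reduced_lam, reduced_a, reduced_μ, reduced_amp]
  have hsl : P.lam * P.α * P.β = P.lam * (1 + P.α * P.β) - P.lam := by ring
  rw [hsl]
  generalize coefD P.α P.β = d at *
  generalize 1 + P.α * P.β = s at *
  generalize 1 + P.α ^ 2 = m at *
  funext i
  fin_cases i
  · simp only [Fin.zero_eta, Pi.zero_apply, Matrix.cons_val]
    field_simp
    ring
  · simp
  · simp only [Fin.reduceFinMk, Pi.zero_apply, Matrix.cons_val]
    field_simp
    linear_combination 8 * s * P.a₄ ^ 2 * hsq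

end IsBranch

end Params

end

end CGL

set_option maxRecDepth 4000 in
theorem mainTheorem2 (μ α β lam a₄ : ℝ) (hμ : 0 < μ) (hBFN : 1 + α * β < 0)
    (hlam : lam ^ 2 + CGL.coefC α β * lam - 2 * CGL.coefA α β * CGL.coefD α β = 0)
    (ha₄ : a₄ ≠ 0) :
    -- the linear part at `ω = μβ`: eigenvalues `0, 0, ±iω₁`, one eigenvector for `0`
    (0 < CGL.eTilde μ α β lam (μ * β) / lam ∧
      (CGL.linPart μ α β lam (μ * β)).charpoly =
        Polynomial.X ^ 2 *
          (Polynomial.X ^ 2 + Polynomial.C (CGL.eTilde μ α β lam (μ * β) / lam)) ∧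
      Module.finrank ℝ (Module.End.eigenspace
        (Matrix.toLin' (CGL.linPart μ α β lam (μ * β))) 0) = 1) ∧
    -- the determining equations, their Jacobian and their simple zero
    ((∀ p : Fin 3 → ℝ, Filter.Tendsto (fun ρ => CGL.startingMap μ α β lam a₄ ρ p)
        (nhdsWithin 0 {0}ᶜ) (nhds (CGL.determiningMap μ α β lam a₄ p))) ∧
      (∀ p : Fin 3 → ℝ,
        DifferentiableAt ℝ (CGL.determiningMap μ α β lam a₄) p ∧
        (fderiv ℝ (CGL.determiningMap μ α β lam a₄) p).det =
          4 * (1 + α * β) ^ 2 * lam ^ 2 * μ * CGL.coefE μ α β (μ * β) / CGL.coefA α β) ∧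
      4 * (1 + α * β) ^ 2 * lam ^ 2 * μ * CGL.coefE μ α β (μ * β) / CGL.coefA α β ≠ 0 ∧
      ∃! p : Fin 3 → ℝ, CGL.determiningMap μ α β lam a₄ p = 0) ∧
    -- the branch of symmetric periodic solutions and of stationary MAWs
    ∃ ρ₀ : ℝ, 0 < ρ₀ ∧
    ∃ (a₂₂ γ ω₃ ω Ω : ℝ → ℝ) (X Y : ℝ → ℝ → Fin 4 → ℝ) (R φ : ℝ → ℝ → ℝ),
      (∀ ρ, ω ρ = CGL.carrierFreq μ α β ρ (a₂₂ ρ) (ω₃ ρ)) ∧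
      (∀ ρ, Ω ρ = CGL.spatialFreq μ α β lam (ω ρ) ρ (γ ρ)) ∧
      (∀ ρ τ, Y ρ τ = CGL.physical μ α β lam (ω ρ) ρ (Ω ρ) τ (X ρ τ)) ∧
      (∀ ρ, R ρ = CGL.amplitude μ α β (ω ρ) (Y ρ)) ∧
      (∀ ρ, φ ρ = CGL.phase μ α β lam (ω ρ) (Y ρ)) ∧
      ContinuousOn a₂₂ (Set.Ioo (-ρ₀) ρ₀) ∧
      ContinuousOn γ (Set.Ioo (-ρ₀) ρ₀) ∧
      ContinuousOn ω₃ (Set.Ioo (-ρ₀) ρ₀) ∧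
      ContinuousOn (fun q : ℝ × ℝ => X q.1 q.2) (Set.Ioo (-ρ₀) ρ₀ ×ˢ Set.univ) ∧
      CGL.determiningMap μ α β lam a₄ ![a₂₂ 0, γ 0, ω₃ 0] = 0 ∧
      (∀ ρ ∈ Set.Ioo (-ρ₀) ρ₀,
        -- frequencies and linear part at `ω ρ`
        CGL.coefE μ α β (ω ρ) = (α * ω ρ + μ) / (1 + α * β)
          + ρ ^ 2 * (ρ ^ 2 * ω₃ ρ - ρ * CGL.coefD α β * (ρ * a₂₂ ρ)) ∧
        0 < CGL.eTilde μ α β lam (ω ρ) / lam ∧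
        0 < Ω ρ ∧
        Ω ρ ^ 2 = CGL.eTilde μ α β lam (ω ρ) / lam + ρ ^ 2 * γ ρ ∧
        Module.finrank ℝ (Module.End.eigenspace
          (Matrix.toLin' (CGL.linPart μ α β lam (ω ρ))) 0) = 1 ∧
        -- symmetric periodic solution of the rescaled system
        (∀ τ, HasDerivAt (X ρ)
          (CGL.rescaledVF μ α β lam (ω ρ) ρ (γ ρ) (Ω ρ) τ (X ρ τ)) τ) ∧
        Function.Periodic (X ρ) (2 * Real.pi / Ω ρ) ∧
        (∀ τ, CGL.reflQ.mulVec (X ρ (-τ)) = X ρ τ) ∧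
        (∀ i, CGL.mean (2 * Real.pi / Ω ρ) (fun τ => X ρ τ i) = ![0, ρ * a₂₂ ρ, 0, a₄] i) ∧
        -- symmetric periodic solution of the 4-D system, with the consistency condition
        (∀ τ, HasDerivAt (Y ρ) (CGL.vf4 μ α β lam (ω ρ) (Y ρ τ)) τ) ∧
        Function.Periodic (Y ρ) (2 * Real.pi / Ω ρ) ∧
        (∀ τ, Y ρ (-τ) = ![Y ρ τ 0, -(Y ρ τ 1), Y ρ τ 2, -(Y ρ τ 3)]) ∧
        (∀ τ, CGL.consistencyDefect μ α β lam (ω ρ) (Y ρ τ) = 0) ∧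
        -- amplitude and phase
        (∀ x, 0 < CGL.coefD α β * Y ρ x 2 + CGL.coefE μ α β (ω ρ)) ∧
        CGL.SolvesAmplitudePhase μ α β (ω ρ) (R ρ) (φ ρ) ∧
        (∀ x, R ρ (-x) = R ρ x ∧ φ ρ (-x) = φ ρ x) ∧
        Function.Periodic (φ ρ) (2 * Real.pi / Ω ρ) ∧
        -- stationary MAW of the CGLe
        (ρ ≠ 0 → CGL.IsStationaryMAW μ α β (2 * Real.pi / Ω ρ) (ω ρ) (R ρ) (φ ρ))) ∧
      -- bifurcation from the homogeneously oscillating state `√μ exp(-iμβt)`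
      TendstoUniformly X (fun _ => ![0, 0, 0, a₄]) (nhds 0) ∧
      Filter.Tendsto ω (nhds 0) (nhds (μ * β)) ∧
      Filter.Tendsto (fun ρ => CGL.coefE μ α β (ω ρ)) (nhds 0) (nhds μ) ∧
      Filter.Tendsto Ω (nhds 0)
        (nhds (Real.sqrt (-(2 * μ * (1 + α * β)) / (1 + α ^ 2)))) ∧
      TendstoUniformly R (fun _ => Real.sqrt μ) (nhds 0) ∧
      TendstoUniformly φ (fun _ => 0) (nhds 0) ∧
      TendstoUniformly (fun ρ => deriv (φ ρ)) (fun _ => 0) (nhds 0) := by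
  have h := CGL.beta_sub_alpha_ne_zero hBFN
  have hl := CGL.root_ne_zero h hlam
  have hdiag := CGL.determiningDiag_ne_zero h hμ.ne' hBFN.ne hl
  let P : CGL.Params := ⟨μ, α, β, lam, a₄⟩
  have hP : P.IsUnstable := ⟨hμ, hBFN, hlam, ha₄⟩
  have he := (CGL.coefE_base h μ).trans_ne hμ.ne'
  refine ⟨⟨CGL.eTilde_base_div_pos hl hμ hBFN, CGL.charpoly_linPart μ α β lam (μ * β),
      CGL.finrank_eigenspace_linPart hl (CGL.coefA_ne_zero h) he⟩,
    ⟨CGL.tendsto_startingMap hμ hBFN hl ha₄,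
      fun p => ⟨(CGL.hasFDerivAt_determiningMap μ α β lam a₄ p).differentiableAt,
        CGL.det_fderiv_determiningMap μ α β lam a₄ p⟩,
      CGL.prod_determiningDiag μ α β lam ▸ Finset.prod_ne_zero_iff.mpr fun i _ => hdiag i,
      CGL.existsUnique_determiningMap a₄ hdiag⟩, ?_⟩
  obtain ⟨u, ρ₀, hb⟩ := hP.exists_branch
  refine ⟨ρ₀, hb.pos, fun ρ => P.reduced.a₂₂ (ρ ^ 2, u ρ), fun ρ => (u ρ).2.2.1,
    fun ρ => P.reduced.ω₃ (ρ ^ 2, u ρ), fun ρ => P.ω ρ (u ρ), fun ρ => P.Ω ρ (u ρ),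
    fun ρ => P.X ρ (u ρ), fun ρ => P.Y ρ (u ρ), _, _,
    fun _ => rfl, fun _ => rfl, fun _ _ => rfl, fun _ => rfl, fun _ => rfl,
    hb.continuousOn_a₂₂, hb.continuousOn_γ, hb.continuousOn_ω₃, hb.continuousOn_X,
    hb.determiningMap_zero, fun ρ hρ => ?_, hb.tendstoUniformly_X, hb.tendsto_ω,
    hb.tendsto_coefE, hb.tendsto_Ω, hb.tendstoUniformly_amplitude, hb.tendstoUniformly_phase,
    hb.tendstoUniformly_deriv_phase⟩
  have hw := hb.isWave ρ hρ
  exact ⟨(CGL.coefE_eq_iff h hBFN.ne).mpr rfl, hP.eTilde_ω_div_lam ▸ hw.ω₁Sq_pos, hw.Ω_pos,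
    hP.eTilde_ω_div_lam ▸ hw.Ω_sq, hw.finrank_eigenspace_linPart, hw.hasDerivAt_X, hw.periodic_X,
    hw.reflQ_mulVec_X_neg, hw.mean_X, hw.isIntegralCurve_Y, hw.periodic_Y, hw.isReversible_Y,
    hw.consistencyDefect_Y, hw.ampSq_Y_pos, hw.solvesAmplitudePhase,
    fun x => ⟨hw.isReversible_Y.even_amplitude x, hw.isReversible_Y.even_phase x⟩,
    hw.periodic_phase, hw.isStationaryMAW⟩
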